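/- Let $k$ be an algebraically closed field with $\operatorname{char}(k)\neq 2$. Let $D_4$ be the $k$-algebra generated by $a,b,c,d$ subject to the relations $$ba=-ab,\quad db=-bd,\quad ca=-ac,\quad dc=-cd,\quad bc=cb,$$ $$a^2=0,\quad b^2=1,\quad c^2=1,\quad d^2=0,\quad da+ad=1-bc,$$ with the comultiplication $$\Delta(a)=a\otimes b+1\otimes a,\quad \Delta(b)=b\otimes b,\quad \Delta(c)=c\otimes c,\quad \Delta(d)=d\otimes c+1\otimes d$$ and the counit $\varepsilon(a)=\varepsilon(d)=0$, $\varepsilon(b)=\varepsilon(c)=1$ (this is the Drinfeld double of Sweedler's $4$-dimensional Hopf algebra). All modules are finite dimensional left $D_4$-modules, and $D_4$ acts on $M\otimes N=M\otimes_k N$ through $\Delta$. For $r\in\mathbb Z/2\mathbb Z$ let $V(r)$ be the one dimensional $D_4$-module on which $a$ and $d$ act as $0$ and $b$ and $c$ act as $(-1)^r$, and let $P(r)$ be the projective cover of $V(r)$. For a module $M$ let $\Omega M$ be the kernel of its projective cover $P(M)\to M$, let $\Omega^{-1}M$ be the cokernel of its injective envelope $M\to I(M)$, and for $s\geq 1$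 let $\Omega^{s}M$ and $\Omega^{-s}M$ be obtained by applying $\Omega$, respectively $\Omega^{-1}$, $s$ times to $M$. Write $nM$ for the direct sum of $n$ copies of $M$. Let $s,t\geq 1$ be integers and let $r,r'\in\mathbb Z/2\mathbb Z$. (1) If $s+t$ is even, then there are isomorphisms of $D_4$-modules $$\Omega^{s}V(r)\otimes\Omega^{t}V(r')\cong\Omega^{s+t}V(r+r')\oplus st\,P(r+r'),$$ $$\Omega^{-s}V(r)\otimes\Omega^{-t}V(r')\cong\Omega^{-(s+t)}V(r+r')\oplus st\,P(r+r').$$ (2) If $s+t$ is odd, then there are isomorphisms of $D_4$-modules $$\Omega^{s}V(r)\otimes\Omega^{t}V(r')\cong\Omega^{s+t}V(r+r')\oplus st\,P(r+r'+1),$$ $$\Omega^{-s}V(r)\otimes\Omega^{-t}V(r')\cong\Omega^{-(s+t)}V(r+r')\oplus st\,P(r+r'+1).$$ -/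

import Mathlib

open scoped TensorProduct

universe u

noncomputable section

/-! ### Finite dimensional modules, projective covers, injective envelopes, syzygies -/

/-- A finite dimensional (left) module over a `k`-algebra `A`. -/
structure FDMod (k : Type u) [Field k] (A : Type u) [Ring A] [Algebra k A] where
  carrier : Type u
  [addCommGroup : AddCommGroup carrier]
  [moduleBase : Module k carrier]
  [module : Module A carrier]
  [tower : IsScalarTower k A carrier]
  [finite : Module.Finite k carrier]

namespace FDMod

instance (k : Type u) [Field k] (A : Type u) [Ring A] [Algebra k A] :
    CoeSort (FDMod k A) (Type u) := ⟨FDMod.carrier⟩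

attribute [instance] addCommGroup moduleBase module tower finite

end FDMod

/-- `π : P → M` is a projective cover: `P` is projective, `π` is onto, and the kernel of `π` is
superfluous in `P`. -/
structure IsProjectiveCover {A P M : Type u} [Ring A] [AddCommGroup P] [Module A P]
    [AddCommGroup M] [Module A M] (π : P →ₗ[A] M) : Prop where
  projective : Module.Projective A P
  surjective : Function.Surjective π
  superfluous : ∀ N : Submodule A P, N ⊔ LinearMap.ker π = ⊤ → N = ⊤

/-- `ι : M → I` is an injective envelope: `I` is injective, `ι` is one-to-one, and the image of
`ι` is essential in `I`. -/
structure IsInjectiveEnvelope {A M I : Type u} [Ring A] [AddCommGroup M] [Module A M]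
    [AddCommGroup I] [Module A I] (ι : M →ₗ[A] I) : Prop where
  injectiveModule : Module.Injective A I
  injective : Function.Injective ι
  essential : ∀ N : Submodule A I, N ⊓ LinearMap.range ι = ⊥ → N = ⊥

section Existence

variable {k : Type u} [Field k] {A : Type u} [Ring A] [Algebra k A]

theorem finite_submodule {M : Type u} [AddCommGroup M] [Module k M] [Module A M]
    [IsScalarTower k A M] [Module.Finite k M] (N : Submodule A M) : Module.Finite k N :=
  inferInstanceAs (Module.Finite k (N.restrictScalars k))

theorem finite_quotient {M : Type u} [AddCommGroup M] [Module k M] [Module A M]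
    [IsScalarTower k A M] [Module.Finite k M] (N : Submodule A M) : Module.Finite k (M ⧸ N) :=
  Module.Finite.of_surjective (N.mkQ.restrictScalars k) N.mkQ_surjective

/-- The submodule `N` of `M` as a finite dimensional module. -/
def FDMod.sub (M : FDMod k A) (N : Submodule A M) : FDMod k A :=
  letI : Module.Finite k N := finite_submodule N
  { carrier := N }

/-- The quotient of `M` by `N` as a finite dimensional module. -/
def FDMod.quot (M : FDMod k A) (N : Submodule A M) : FDMod k A :=
  letI : Module.Finite k (M ⧸ N) := finite_quotient N
  { carrier := M ⧸ N }

theorem exists_fitting {M : Type u} [AddCommGroup M] [Module k M] [Module A M]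
    [IsScalarTower k A M] [Module.Finite k M] (g : Module.End A M) :
    ∃ n, IsCompl (LinearMap.ker (g ^ (n + 1))) (LinearMap.range (g ^ (n + 1))) := by
  have : IsNoetherian A M := isNoetherian_of_tower k inferInstance
  have : IsArtinian A M := isArtinian_of_tower k inferInstance
  obtain ⟨N, hN⟩ := Filter.eventually_atTop.1 (g.eventually_isCompl_ker_pow_range_pow)
  exact ⟨N, hN (N + 1) (Nat.le_succ N)⟩

theorem eq_top_of_finrank_le {M : Type u} [AddCommGroup M] [Module k M] [Module A M]
    [IsScalarTower k A M] [Module.Finite k M] (R : Submodule A M)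
    (h : Module.finrank k M ≤ Module.finrank k R) : R = ⊤ := by
  have hRtop : R.restrictScalars k = ⊤ :=
    Submodule.eq_top_of_finrank_eq (le_antisymm (Submodule.finrank_le _) h)
  rw [eq_top_iff]
  intro x _
  have : x ∈ R.restrictScalars k := hRtop ▸ Submodule.mem_top
  exact this

/-- Over a finite dimensional algebra every finite dimensional module has a projective cover. -/
theorem exists_projectiveCover [Module.Finite k A] (M : FDMod k A) :
    ∃ (P : FDMod k A) (π : P →ₗ[A] M), IsProjectiveCover π := by
  classical
  have hex : ∃ n : ℕ, ∃ (P : FDMod k A) (π : P →ₗ[A] M),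
      Module.Projective A P ∧ Function.Surjective π ∧ Module.finrank k P = n := by
    have : Module.Finite A M := Module.Finite.of_restrictScalars_finite k A M
    obtain ⟨n, f, hf⟩ := Module.Finite.exists_fin' A M
    exact ⟨_, { carrier := Fin n → A }, f,
      inferInstanceAs (Module.Projective A (Fin n → A)), hf, rfl⟩
  obtain ⟨P, π, hP, hπ, hn⟩ := Nat.find_spec hex
  refine ⟨P, π, hP, hπ, fun N hN => ?_⟩
  have hsurj : Function.Surjective (π.comp N.subtype) := by
    intro m
    obtain ⟨p, rfl⟩ := hπ m
    have hp : p ∈ N ⊔ LinearMap.ker π := hN ▸ Submodule.mem_top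
    obtain ⟨y, hy, z, hz, rfl⟩ := Submodule.mem_sup.1 hp
    refine ⟨⟨y, hy⟩, ?_⟩
    simp [LinearMap.mem_ker.1 hz]
  obtain ⟨f, hf⟩ := Module.projective_lifting_property (π.comp N.subtype) π hsurj
  let g : Module.End A P := N.subtype.comp f
  have hg : ∀ x, π (g x) = π x := fun x => LinearMap.congr_fun hf x
  have hgn : ∀ n x, π ((g ^ n) x) = π x := by
    intro n
    induction n with
    | zero => intro x; simp
    | succ n ih => intro x; rw [pow_succ', Module.End.mul_apply, hg, ih]
  obtain ⟨n, hc⟩ := exists_fitting (k := k) g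
  have hproj : Module.Projective A (LinearMap.range (g ^ (n + 1))) :=
    Module.Projective.of_split (LinearMap.range (g ^ (n + 1))).subtype
      (Submodule.projectionOnto _ _ hc.symm) (by ext x; simp)
  have hmin := Nat.find_min' hex ⟨P.sub (LinearMap.range (g ^ (n + 1))),
    π.comp (LinearMap.range (g ^ (n + 1))).subtype, hproj, fun m => by
      obtain ⟨p, rfl⟩ := hπ m
      exact ⟨⟨(g ^ (n + 1)) p, ⟨p, rfl⟩⟩, hgn (n + 1) p⟩, rfl⟩
  rw [← hn] at hmin
  have htop := eq_top_of_finrank_le (k := k) _ hmin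
  rw [eq_top_iff]
  intro x _
  obtain ⟨y, rfl⟩ := LinearMap.range_eq_top.1 htop x
  rw [pow_succ', Module.End.mul_apply]
  exact (f ((g ^ n) y)).2

/-- The coinduced module `Hom_k(A, M)`, with action `(x • φ) y = φ (y * x)`. -/
def Coind (k A M : Type u) [Field k] [Ring A] [Algebra k A] [AddCommGroup M] [Module k M] :
    Type u := A →ₗ[k] M

namespace Coind

variable {M : Type u} [AddCommGroup M] [Module k M]

instance : AddCommGroup (Coind k A M) := inferInstanceAs (AddCommGroup (A →ₗ[k] M))
instance : Module k (Coind k A M) := inferInstanceAs (Module k (A →ₗ[k] M))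
instance [Module.Finite k A] [Module.Finite k M] : Module.Finite k (Coind k A M) :=
  inferInstanceAs (Module.Finite k (A →ₗ[k] M))

instance : Module A (Coind k A M) where
  smul x φ := LinearMap.comp (show A →ₗ[k] M from φ) (LinearMap.mulRight k x)
  one_smul φ := LinearMap.ext fun y => congrArg (show A →ₗ[k] M from φ) (mul_one y)
  mul_smul x x' φ := LinearMap.ext fun y =>
    congrArg (show A →ₗ[k] M from φ) (mul_assoc y x x').symm
  smul_zero _ := LinearMap.ext fun _ => rfl
  smul_add _ _ _ := LinearMap.ext fun _ => rfl
  add_smul x x' φ := LinearMap.ext fun y =>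
    (congrArg (show A →ₗ[k] M from φ) (mul_add y x x')).trans (map_add _ _ _)
  zero_smul φ := LinearMap.ext fun y =>
    (congrArg (show A →ₗ[k] M from φ) (mul_zero y)).trans (map_zero _)

instance : IsScalarTower k A (Coind k A M) where
  smul_assoc c x φ := LinearMap.ext fun y =>
    (congrArg (show A →ₗ[k] M from φ) (mul_smul_comm c y x)).trans (map_smul _ _ _)

/-- Coinduced modules are injective. -/
theorem injective : Module.Injective A (Coind k A M) where
  out X Y _ _ _ _ f hf g := by
    let _ : Module k X := Module.restrictScalars k A X
    let _ : Module k Y := Module.restrictScalars k A Y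
    have : IsScalarTower k A X := IsScalarTower.restrictScalars k A X
    have : IsScalarTower k A Y := IsScalarTower.restrictScalars k A Y
    obtain ⟨p, hp⟩ := (f.restrictScalars k).exists_leftInverse_of_injective
      (LinearMap.ker_eq_bot.2 hf)
    have hp' : ∀ x, p (f x) = x := fun x => LinearMap.congr_fun hp x
    let ev : X →ₗ[k] M :=
      { toFun := fun x => (show A →ₗ[k] M from g x) 1
        map_add' := fun x y => by rw [map_add]; rfl
        map_smul' := fun c x => by
          rw [← algebraMap_smul A c x, map_smul, algebraMap_smul]; rfl }
    have hev : ∀ (y : A) (x : X), ev (y • x) = (show A →ₗ[k] M from g x) y := by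
      intro y x
      change (show A →ₗ[k] M from g (y • x)) 1 = _
      rw [map_smul]
      exact congrArg (show A →ₗ[k] M from g x) (one_mul y)
    let h : Y →ₗ[A] Coind k A M :=
      { toFun := fun y => (ev.comp p).comp ((LinearMap.toSpanSingleton A Y y).restrictScalars k)
        map_add' := fun y y' => LinearMap.ext fun z => by
          change ev (p (z • (y + y'))) = ev (p (z • y)) + ev (p (z • y'))
          rw [smul_add, map_add, map_add]
        map_smul' := fun x y => LinearMap.ext fun z => by
          change ev (p (z • x • y)) = ev (p ((z * x) • y))
          rw [mul_smul] }
    refine ⟨h, fun x => LinearMap.ext fun z => ?_⟩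
    change ev (p (z • f x)) = _
    rw [← map_smul, hp', hev]

/-- The canonical embedding of a module into a coinduced module. -/
def embed (k A M : Type u) [Field k] [Ring A] [Algebra k A] [AddCommGroup M] [Module k M]
    [Module A M] [IsScalarTower k A M] : M →ₗ[A] Coind k A M where
  toFun m := (LinearMap.toSpanSingleton A M m).restrictScalars k
  map_add' m m' := LinearMap.ext fun y => smul_add y m m'
  map_smul' x m := LinearMap.ext fun y => (mul_smul y x m).symm

theorem embed_injective [Module A M] [IsScalarTower k A M] :
    Function.Injective (embed k A M) := fun m m' h => by
  have := LinearMap.congr_fun (show (LinearMap.toSpanSingleton A M m).restrictScalars k =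
    (LinearMap.toSpanSingleton A M m').restrictScalars k from h) 1
  simpa using this

end Coind

theorem injective_of_split {I J : Type u} [AddCommGroup I] [Module A I] [AddCommGroup J]
    [Module A J] (i : J →ₗ[A] I) (s : I →ₗ[A] J) (h : ∀ x, s (i x) = x)
    (hI : Module.Injective A I) : Module.Injective A J where
  out X Y _ _ _ _ f hf g := by
    obtain ⟨e, he⟩ := hI.out f hf (i.comp g)
    exact ⟨s.comp e, fun x => by simp [he, h]⟩

/-- Over a finite dimensional algebra every finite dimensional module has a finite dimensional
injective envelope. -/
theorem exists_injectiveEnvelope [Module.Finite k A] (M : FDMod k A) :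
    ∃ (I : FDMod k A) (ι : M →ₗ[A] I), IsInjectiveEnvelope ι := by
  classical
  have hex : ∃ n : ℕ, ∃ (I : FDMod k A) (ι : M →ₗ[A] I),
      Module.Injective A I ∧ Function.Injective ι ∧ Module.finrank k I = n :=
    ⟨_, { carrier := Coind k A M }, Coind.embed k A M, Coind.injective,
      Coind.embed_injective, rfl⟩
  obtain ⟨I, ι, hI, hι, hn⟩ := Nat.find_spec hex
  refine ⟨I, ι, hI, hι, fun N hN => ?_⟩
  have hinj : Function.Injective (N.mkQ.comp ι) := by
    rw [← LinearMap.ker_eq_bot, eq_bot_iff]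
    intro m hm
    have h1 : ι m ∈ N := by simpa using hm
    have h2 : ι m ∈ N ⊓ LinearMap.range ι := ⟨h1, m, rfl⟩
    rw [hN, Submodule.mem_bot] at h2
    exact (Submodule.mem_bot A).2 (hι (by rw [h2, map_zero]))
  obtain ⟨f, hf⟩ := hI.out (N.mkQ.comp ι) hinj ι
  let g : Module.End A I := f.comp N.mkQ
  have hg : ∀ x, g (ι x) = ι x := hf
  have hgn : ∀ n x, (g ^ n) (ι x) = ι x := by
    intro n
    induction n with
    | zero => intro x; simp
    | succ n ih => intro x; rw [pow_succ', Module.End.mul_apply, ih, hg]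
  obtain ⟨n, hc⟩ := exists_fitting (k := k) g
  have hRinj : Module.Injective A (LinearMap.range (g ^ (n + 1))) :=
    injective_of_split (LinearMap.range (g ^ (n + 1))).subtype
      (Submodule.projectionOnto _ _ hc.symm) (fun x => by simp) hI
  have hmin := Nat.find_min' hex ⟨I.sub (LinearMap.range (g ^ (n + 1))),
    ι.codRestrict (LinearMap.range (g ^ (n + 1))) (fun x => ⟨ι x, hgn (n + 1) x⟩), hRinj,
    fun x y hxy => hι (congrArg Subtype.val hxy), rfl⟩
  rw [← hn] at hmin
  have htop := eq_top_of_finrank_le (k := k) _ hmin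
  have hker := hc.inf_eq_bot
  rw [htop, inf_top_eq] at hker
  rw [eq_bot_iff, ← hker]
  intro x hx
  have h0 : g x = 0 := by
    change f (N.mkQ x) = 0
    rw [Submodule.mkQ_apply, (Submodule.Quotient.mk_eq_zero N).2 hx, map_zero]
  rw [LinearMap.mem_ker, pow_succ, Module.End.mul_apply, h0, map_zero]

end Existence

namespace FDMod

variable {k : Type u} [Field k] {A : Type u} [Ring A] [Algebra k A]

/-- The projective cover `P(M)` of `M` (unique up to isomorphism). -/
def projCover [Module.Finite k A] (M : FDMod k A) : FDMod k A :=
  (exists_projectiveCover M).choose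

/-- The covering map `P(M) → M`. -/
def projCoverMap [Module.Finite k A] (M : FDMod k A) : M.projCover →ₗ[A] M :=
  (exists_projectiveCover M).choose_spec.choose

theorem isProjectiveCover_projCoverMap [Module.Finite k A] (M : FDMod k A) :
    IsProjectiveCover M.projCoverMap :=
  (exists_projectiveCover M).choose_spec.choose_spec

/-- The injective envelope `I(M)` of `M` (unique up to isomorphism). -/
def injEnvelope [Module.Finite k A] (M : FDMod k A) : FDMod k A :=
  (exists_injectiveEnvelope M).choose

/-- The embedding `M → I(M)`. -/
def injEnvelopeMap [Module.Finite k A] (M : FDMod k A) : M →ₗ[A] M.injEnvelope :=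
  (exists_injectiveEnvelope M).choose_spec.choose

theorem isInjectiveEnvelope_injEnvelopeMap [Module.Finite k A] (M : FDMod k A) :
    IsInjectiveEnvelope M.injEnvelopeMap :=
  (exists_injectiveEnvelope M).choose_spec.choose_spec

/-- The first syzygy `Ω M = Ker (P(M) → M)`. -/
def syzygyOne [Module.Finite k A] (M : FDMod k A) : FDMod k A :=
  M.projCover.sub (LinearMap.ker M.projCoverMap)

/-- The first cosyzygy `Ω⁻¹ M = Coker (M → I(M))`. -/
def cosyzygyOne [Module.Finite k A] (M : FDMod k A) : FDMod k A :=
  M.injEnvelope.quot (LinearMap.range M.injEnvelopeMap)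

/-- The `s`-th syzygy `Ω^s M`, that is, the `s`-th kernel in a minimal projective resolution. -/
def syzygy [Module.Finite k A] (s : ℕ) (M : FDMod k A) : FDMod k A := syzygyOne^[s] M

/-- The `s`-th cosyzygy `Ω^{-s} M`, that is, the `s`-th cokernel in a minimal injective
resolution. -/
def cosyzygy [Module.Finite k A] (s : ℕ) (M : FDMod k A) : FDMod k A := cosyzygyOne^[s] M

end FDMod

/-! ### Tensor products of modules over a bialgebra -/

/-- The tensor product over `k` of two modules over a bialgebra `A`, on which `A` acts through
the comultiplication. It is a type synonym, since `M ⊗[k] N` itself carries the action of `A` on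
the left factor. -/
def DiagTensor (k A M N : Type u) [Field k] [Ring A] [Bialgebra k A]
    [AddCommGroup M] [Module k M] [Module A M] [IsScalarTower k A M]
    [AddCommGroup N] [Module k N] [Module A N] [IsScalarTower k A N] : Type u := M ⊗[k] N

namespace DiagTensor

variable {k A M N : Type u} [Field k] [Ring A] [Bialgebra k A]
  [AddCommGroup M] [Module k M] [Module A M] [IsScalarTower k A M]
  [AddCommGroup N] [Module k N] [Module A N] [IsScalarTower k A N]

instance : AddCommGroup (DiagTensor k A M N) := inferInstanceAs (AddCommGroup (M ⊗[k] N))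
instance : Module k (DiagTensor k A M N) := inferInstanceAs (Module k (M ⊗[k] N))
instance [Module.Finite k M] [Module.Finite k N] : Module.Finite k (DiagTensor k A M N) :=
  inferInstanceAs (Module.Finite k (M ⊗[k] N))

/-- The representation of `A` on `M ⊗ N` given by the comultiplication:
`x` acts as `∑ x₁ ⊗ x₂` if `Δ x = ∑ x₁ ⊗ x₂`. -/
def rho (k A M N : Type u) [Field k] [Ring A] [Bialgebra k A]
    [AddCommGroup M] [Module k M] [Module A M] [IsScalarTower k A M]
    [AddCommGroup N] [Module k N] [Module A N] [IsScalarTower k A N] :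
    A →ₐ[k] Module.End k (M ⊗[k] N) :=
  ((Module.endTensorEndAlgHom (R := k) (S := k) (A := k) (M := M) (N := N)).comp
    (Algebra.TensorProduct.map (Algebra.lsmul k k M) (Algebra.lsmul k k N))).comp
    (Bialgebra.comulAlgHom k A)

instance : Module A (DiagTensor k A M N) where
  smul x z := rho k A M N x z
  one_smul z := by change rho k A M N 1 z = z; rw [map_one]; rfl
  mul_smul x y z := by
    change rho k A M N (x * y) z = rho k A M N x (rho k A M N y z); rw [map_mul]; rfl
  smul_zero x := map_zero (rho k A M N x)
  smul_add x := map_add (rho k A M N x)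
  add_smul x y z := by
    change rho k A M N (x + y) z = rho k A M N x z + rho k A M N y z; rw [map_add]; rfl
  zero_smul z := by change rho k A M N 0 z = 0; rw [map_zero]; rfl

instance : IsScalarTower k A (DiagTensor k A M N) where
  smul_assoc c x z := by
    change rho k A M N (c • x) z = c • rho k A M N x z; rw [map_smul]; rfl

end DiagTensor

/-- The tensor product of two finite dimensional modules over a bialgebra. -/
def FDMod.tensor {k A : Type u} [Field k] [Ring A] [Bialgebra k A] (M N : FDMod k A) :
    FDMod k A :=
  { carrier := DiagTensor k A M N }

/-! ### The Hopf algebra `D₄` -/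

/-- The four generators of `D₄`. -/
inductive D4Gen : Type
  | a | b | c | d

/-- The defining relations of `D₄`. -/
inductive D4Rel (k : Type u) [Field k] : FreeAlgebra k D4Gen → FreeAlgebra k D4Gen → Prop
  | ba : D4Rel k (FreeAlgebra.ι k .b * FreeAlgebra.ι k .a)
      (-(FreeAlgebra.ι k .a * FreeAlgebra.ι k .b))
  | db : D4Rel k (FreeAlgebra.ι k .d * FreeAlgebra.ι k .b)
      (-(FreeAlgebra.ι k .b * FreeAlgebra.ι k .d))
  | ca : D4Rel k (FreeAlgebra.ι k .c * FreeAlgebra.ι k .a)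
      (-(FreeAlgebra.ι k .a * FreeAlgebra.ι k .c))
  | dc : D4Rel k (FreeAlgebra.ι k .d * FreeAlgebra.ι k .c)
      (-(FreeAlgebra.ι k .c * FreeAlgebra.ι k .d))
  | bc : D4Rel k (FreeAlgebra.ι k .b * FreeAlgebra.ι k .c)
      (FreeAlgebra.ι k .c * FreeAlgebra.ι k .b)
  | aa : D4Rel k (FreeAlgebra.ι k .a * FreeAlgebra.ι k .a) 0
  | bb : D4Rel k (FreeAlgebra.ι k .b * FreeAlgebra.ι k .b) 1
  | cc : D4Rel k (FreeAlgebra.ι k .c * FreeAlgebra.ι k .c) 1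
  | dd : D4Rel k (FreeAlgebra.ι k .d * FreeAlgebra.ι k .d) 0
  | da : D4Rel k (FreeAlgebra.ι k .d * FreeAlgebra.ι k .a
        + FreeAlgebra.ι k .a * FreeAlgebra.ι k .d)
      (1 - FreeAlgebra.ι k .b * FreeAlgebra.ι k .c)

/-- The algebra `D₄` generated by `a, b, c, d` subject to the relations above. -/
def D4 (k : Type u) [Field k] : Type u := RingQuot (D4Rel k)

namespace D4

variable (k : Type u) [Field k]

instance : Ring (D4 k) := inferInstanceAs (Ring (RingQuot (D4Rel k)))
instance : Algebra k (D4 k) := inferInstanceAs (Algebra k (RingQuot (D4Rel k)))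

/-- The quotient map from the free algebra. -/
def mk : FreeAlgebra k D4Gen →ₐ[k] D4 k := RingQuot.mkAlgHom k (D4Rel k)

theorem mk_surjective : Function.Surjective (mk k) := RingQuot.mkAlgHom_surjective k (D4Rel k)

/-- The generators of `D₄`. -/
def gen (x : D4Gen) : D4 k := mk k (FreeAlgebra.ι k x)

variable {k}

theorem mk_rel {x y : FreeAlgebra k D4Gen} (h : D4Rel k x y) : mk k x = mk k y :=
  RingQuot.mkAlgHom_rel k h

theorem ba : gen k .b * gen k .a = -(gen k .a * gen k .b) := by simpa [gen] using mk_rel (k := k) .ba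
theorem db : gen k .d * gen k .b = -(gen k .b * gen k .d) := by simpa [gen] using mk_rel (k := k) .db
theorem ca : gen k .c * gen k .a = -(gen k .a * gen k .c) := by simpa [gen] using mk_rel (k := k) .ca
theorem dc : gen k .d * gen k .c = -(gen k .c * gen k .d) := by simpa [gen] using mk_rel (k := k) .dc
theorem bc : gen k .b * gen k .c = gen k .c * gen k .b := by simpa [gen] using mk_rel (k := k) .bc
theorem aa : gen k .a * gen k .a = 0 := by simpa [gen] using mk_rel (k := k) .aa
theorem bb : gen k .b * gen k .b = 1 := by simpa [gen] using mk_rel (k := k) .bb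
theorem cc : gen k .c * gen k .c = 1 := by simpa [gen] using mk_rel (k := k) .cc
theorem dd : gen k .d * gen k .d = 0 := by simpa [gen] using mk_rel (k := k) .dd
theorem da : gen k .d * gen k .a + gen k .a * gen k .d = 1 - gen k .b * gen k .c := by
  simpa [gen] using mk_rel (k := k) .da

/-- Elements of a `k`-algebra that satisfy the defining relations of `D₄`. -/
structure Satisfies {B : Type u} [Ring B] (a b c d : B) : Prop where
  ba : b * a = -(a * b)
  db : d * b = -(b * d)
  ca : c * a = -(a * c)
  dc : d * c = -(c * d)
  bc : b * c = c * b
  aa : a * a = 0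
  bb : b * b = 1
  cc : c * c = 1
  dd : d * d = 0
  da : d * a + a * d = 1 - b * c

/-- The choice of the values of the four generators. -/
def onGen {B : Type u} (a b c d : B) : D4Gen → B
  | .a => a
  | .b => b
  | .c => c
  | .d => d

/-- The universal property of `D₄`. -/
def lift {B : Type u} [Ring B] [Algebra k B] {a b c d : B} (h : Satisfies a b c d) :
    D4 k →ₐ[k] B :=
  RingQuot.liftAlgHom k ⟨FreeAlgebra.lift k (onGen a b c d), by
    intro x y hxy
    cases hxy
    case ba => simpa [onGen] using h.ba
    case db => simpa [onGen] using h.db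
    case ca => simpa [onGen] using h.ca
    case dc => simpa [onGen] using h.dc
    case bc => simpa [onGen] using h.bc
    case aa => simpa [onGen] using h.aa
    case bb => simpa [onGen] using h.bb
    case cc => simpa [onGen] using h.cc
    case dd => simpa [onGen] using h.dd
    case da => simpa [onGen] using h.da⟩

@[simp] theorem lift_gen {B : Type u} [Ring B] [Algebra k B] {a b c d : B}
    (h : Satisfies a b c d) (x : D4Gen) : lift (k := k) h (gen k x) = onGen a b c d x := by
  have := RingQuot.liftAlgHom_mkAlgHom_apply (S := k) (A := FreeAlgebra k D4Gen) (B := B)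
    (s := D4Rel k) (FreeAlgebra.lift k (onGen a b c d))
  exact (this _ _).trans (by simp)

theorem algHom_ext {B : Type u} [Ring B] [Algebra k B] {f g : D4 k →ₐ[k] B}
    (h : ∀ x, f (gen k x) = g (gen k x)) : f = g := by
  apply RingQuot.ringQuot_ext'
  apply FreeAlgebra.hom_ext
  funext x
  exact h x

/-- The four group-like and skew-primitive elements `Δ(a), Δ(b), Δ(c), Δ(d)` satisfy the
defining relations. -/
theorem satisfies_comul : Satisfies (B := D4 k ⊗[k] D4 k)
    (gen k .a ⊗ₜ gen k .b + 1 ⊗ₜ gen k .a) (gen k .b ⊗ₜ gen k .b)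
    (gen k .c ⊗ₜ gen k .c) (gen k .d ⊗ₜ gen k .c + 1 ⊗ₜ gen k .d) where
  ba := by
    simp only [mul_add, add_mul, Algebra.TensorProduct.tmul_mul_tmul, one_mul, mul_one, ba,
      TensorProduct.neg_tmul, TensorProduct.tmul_neg, neg_add]
  db := by
    simp only [mul_add, add_mul, Algebra.TensorProduct.tmul_mul_tmul, one_mul, mul_one, db, bc,
      TensorProduct.neg_tmul, TensorProduct.tmul_neg, neg_add]
  ca := by
    simp only [mul_add, add_mul, Algebra.TensorProduct.tmul_mul_tmul, one_mul, mul_one, ca, bc,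
      TensorProduct.neg_tmul, TensorProduct.tmul_neg, neg_add]
  dc := by
    simp only [mul_add, add_mul, Algebra.TensorProduct.tmul_mul_tmul, one_mul, mul_one, dc,
      TensorProduct.neg_tmul, TensorProduct.tmul_neg, neg_add]
  bc := by simp only [Algebra.TensorProduct.tmul_mul_tmul, bc]
  aa := by
    simp only [mul_add, add_mul, Algebra.TensorProduct.tmul_mul_tmul, one_mul, mul_one, ba, aa,
      TensorProduct.zero_tmul, TensorProduct.tmul_zero, TensorProduct.tmul_neg]
    abel
  bb := by
    simp only [Algebra.TensorProduct.tmul_mul_tmul, bb, Algebra.TensorProduct.one_def]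
  cc := by
    simp only [Algebra.TensorProduct.tmul_mul_tmul, cc, Algebra.TensorProduct.one_def]
  dd := by
    simp only [mul_add, add_mul, Algebra.TensorProduct.tmul_mul_tmul, one_mul, mul_one, dc, dd,
      TensorProduct.zero_tmul, TensorProduct.tmul_zero, TensorProduct.tmul_neg]
    abel
  da := by
    have h : gen k .d * gen k .a = 1 - gen k .b * gen k .c - gen k .a * gen k .d :=
      eq_sub_of_add_eq da
    simp only [mul_add, add_mul, Algebra.TensorProduct.tmul_mul_tmul, one_mul, mul_one, ca, db, h,
      ← bc, TensorProduct.sub_tmul, TensorProduct.tmul_sub, TensorProduct.tmul_neg,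
      Algebra.TensorProduct.one_def]
    abel

/-- The comultiplication: `Δ(a) = a ⊗ b + 1 ⊗ a`, `Δ(b) = b ⊗ b`, `Δ(c) = c ⊗ c`,
`Δ(d) = d ⊗ c + 1 ⊗ d`. -/
def comul (k : Type u) [Field k] : D4 k →ₐ[k] D4 k ⊗[k] D4 k := lift satisfies_comul

theorem satisfies_char (z : k) (hz : z * z = 1) : Satisfies (B := k) 0 z z 0 where
  ba := by simp
  db := by simp
  ca := by simp
  dc := by simp
  bc := rfl
  aa := by simp
  bb := hz
  cc := hz
  dd := by simp
  da := by simp [hz]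

/-- The counit: `ε(a) = ε(d) = 0`, `ε(b) = ε(c) = 1`. -/
def counit (k : Type u) [Field k] : D4 k →ₐ[k] k := lift (satisfies_char 1 (one_mul 1))

instance : Bialgebra k (D4 k) :=
  Bialgebra.ofAlgHom (comul k) (counit k)
    (by
      apply algHom_ext
      rintro (_ | _ | _ | _) <;>
        simp [comul, onGen, TensorProduct.add_tmul, TensorProduct.tmul_add,
          Algebra.TensorProduct.one_def, add_assoc])
    (by
      apply algHom_ext
      rintro (_ | _ | _ | _) <;> simp [comul, counit, onGen])
    (by
      apply algHom_ext
      rintro (_ | _ | _ | _) <;> simp [comul, counit, onGen])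

section Finite

/-- The subspace `S + x S`. -/
def thicken (x : D4 k) (S : Submodule k (D4 k)) : Submodule k (D4 k) :=
  S ⊔ S.map (LinearMap.mulLeft k x)

theorem mem_thicken {x : D4 k} {S : Submodule k (D4 k)} {y : D4 k} :
    y ∈ thicken x S ↔ ∃ s ∈ S, ∃ t ∈ S, s + x * t = y := by
  simp [thicken, Submodule.mem_sup]

theorem mul_mem_thicken {x y : D4 k} {S : Submodule k (D4 k)}
    (h1 : ∀ s ∈ S, y * s ∈ thicken x S) (h2 : ∀ s ∈ S, y * (x * s) ∈ thicken x S) :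
    ∀ s ∈ thicken x S, y * s ∈ thicken x S := by
  intro s hs
  obtain ⟨s, hs', t, ht, rfl⟩ := mem_thicken.1 hs
  rw [mul_add]
  exact add_mem (h1 s hs') (h2 t ht)

theorem mul_mem_thicken_of_anti {x y : D4 k} {S : Submodule k (D4 k)}
    (h : ∀ s ∈ S, y * s ∈ S) (hxy : y * x = -(x * y)) :
    ∀ s ∈ thicken x S, y * s ∈ thicken x S :=
  mul_mem_thicken (fun s hs => mem_thicken.2 ⟨_, h s hs, 0, zero_mem _, by simp⟩)
    (fun s hs => mem_thicken.2 ⟨0, zero_mem _, -(y * s), neg_mem (h s hs), by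
      rw [← mul_assoc, hxy]; simp [mul_assoc]⟩)

theorem mul_mem_thicken_of_comm {x y : D4 k} {S : Submodule k (D4 k)}
    (h : ∀ s ∈ S, y * s ∈ S) (hxy : y * x = x * y) :
    ∀ s ∈ thicken x S, y * s ∈ thicken x S :=
  mul_mem_thicken (fun s hs => mem_thicken.2 ⟨_, h s hs, 0, zero_mem _, by simp⟩)
    (fun s hs => mem_thicken.2 ⟨0, zero_mem _, y * s, h s hs, by
      rw [zero_add, ← mul_assoc, ← hxy, mul_assoc]⟩)

theorem mul_mem_thicken_self {x : D4 k} {S : Submodule k (D4 k)} (z : k)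
    (hx : x * x = algebraMap k _ z) :
    ∀ s ∈ thicken x S, x * s ∈ thicken x S :=
  mul_mem_thicken (fun s hs => mem_thicken.2 ⟨0, zero_mem _, s, hs, by simp⟩)
    (fun s hs => mem_thicken.2 ⟨z • s, S.smul_mem _ hs, 0, zero_mem _, by
      rw [← mul_assoc, hx, ← Algebra.smul_def]; simp⟩)

/-- `D₄` is finite dimensional (it is spanned by the monomials `a^i b^j c^l d^m` with exponents
`0` or `1`). -/
instance : Module.Finite k (D4 k) := by
  let S0 : Submodule k (D4 k) := thicken (gen k .d) (Submodule.span k {1})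
  let S1 := thicken (gen k .c) S0
  let S2 := thicken (gen k .b) S1
  let S3 := thicken (gen k .a) S2
  have hle : ∀ (x : D4 k) (S : Submodule k (D4 k)), S ≤ thicken x S := fun x S => le_sup_left
  have d0 : ∀ s ∈ S0, gen k .d * s ∈ S0 := mul_mem_thicken_self 0 (by simp [dd])
  have d1 : ∀ s ∈ S1, gen k .d * s ∈ S1 := mul_mem_thicken_of_anti d0 dc
  have c1 : ∀ s ∈ S1, gen k .c * s ∈ S1 := mul_mem_thicken_self 1 (by simp [cc])
  have d2 : ∀ s ∈ S2, gen k .d * s ∈ S2 := mul_mem_thicken_of_anti d1 db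
  have c2 : ∀ s ∈ S2, gen k .c * s ∈ S2 := mul_mem_thicken_of_comm c1 bc.symm
  have b2 : ∀ s ∈ S2, gen k .b * s ∈ S2 := mul_mem_thicken_self 1 (by simp [bb])
  have a3 : ∀ s ∈ S3, gen k .a * s ∈ S3 := mul_mem_thicken_self 0 (by simp [aa])
  have b3 : ∀ s ∈ S3, gen k .b * s ∈ S3 := mul_mem_thicken_of_anti b2 ba
  have c3 : ∀ s ∈ S3, gen k .c * s ∈ S3 := mul_mem_thicken_of_anti c2 ca
  have d3 : ∀ s ∈ S3, gen k .d * s ∈ S3 := by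
    refine mul_mem_thicken (fun s hs => hle _ _ (d2 s hs)) (fun s hs => mem_thicken.2
      ⟨s - gen k .b * (gen k .c * s), sub_mem hs (b2 _ (c2 _ hs)), -(gen k .d * s),
        neg_mem (d2 s hs), ?_⟩)
    rw [← mul_assoc (gen k .d) (gen k .a), eq_sub_of_add_eq (da (k := k))]
    simp only [add_mul, neg_mul, one_mul, mul_neg, mul_assoc, sub_eq_add_neg]
  have hone : (1 : D4 k) ∈ S3 :=
    hle _ _ (hle _ _ (hle _ _ (hle _ _ (Submodule.mem_span_singleton_self _))))
  have hall : ∀ x : FreeAlgebra k D4Gen, ∀ s ∈ S3, mk k x * s ∈ S3 := by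
    intro x
    induction x using FreeAlgebra.induction with
    | grade0 r =>
      intro s hs
      rw [AlgHom.commutes, ← Algebra.smul_def]
      exact S3.smul_mem _ hs
    | grade1 g =>
      cases g
      exacts [a3, b3, c3, d3]
    | mul x y hx hy =>
      intro s hs
      rw [map_mul, mul_assoc]
      exact hx _ (hy _ hs)
    | add x y hx hy =>
      intro s hs
      rw [map_add, add_mul]
      exact add_mem (hx _ hs) (hy _ hs)
  have htop : S3 = ⊤ := by
    rw [eq_top_iff]
    intro y _
    obtain ⟨x, rfl⟩ := mk_surjective k y
    simpa using hall x 1 hone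
  have hfin : S3.FG := by
    have h : ∀ (x : D4 k) (S : Submodule k (D4 k)), S.FG → (thicken x S).FG :=
      fun x S hS => hS.sup (hS.map _)
    exact h _ _ (h _ _ (h _ _ (h _ _ (Submodule.fg_span_singleton 1))))
  exact ⟨htop ▸ hfin⟩

end Finite

/-! ### The modules `V(r)` and `P(r)` -/

/-- The sign `(-1)^r` for `r ∈ ℤ/2`. -/
def sign (k : Type u) [Field k] (r : ZMod 2) : k := (-1) ^ r.val

theorem sign_mul_self (r : ZMod 2) : sign k r * sign k r = 1 := by
  rw [sign, ← mul_pow]; simp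

/-- The character of `D₄` with `a, d ↦ 0` and `b, c ↦ (-1)^r`. -/
def character (k : Type u) [Field k] (r : ZMod 2) : D4 k →ₐ[k] k :=
  lift (satisfies_char (sign k r) (sign_mul_self r))

/-- The carrier of `V(r)`, a copy of the ground field. -/
def VCarrier (k : Type u) (_r : ZMod 2) : Type u := k

instance (r : ZMod 2) : AddCommGroup (VCarrier k r) := inferInstanceAs (AddCommGroup k)
instance (r : ZMod 2) : Module k (VCarrier k r) := inferInstanceAs (Module k k)
instance (r : ZMod 2) : Module.Finite k (VCarrier k r) := inferInstanceAs (Module.Finite k k)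
instance (r : ZMod 2) : Module (D4 k) (VCarrier k r) :=
  Module.compHom k (character k r).toRingHom
instance (r : ZMod 2) : IsScalarTower k (D4 k) (VCarrier k r) where
  smul_assoc z x v := by
    change character k r (z • x) * (show k from v) = z * (character k r x * (show k from v))
    rw [map_smul, smul_eq_mul, mul_assoc]

/-- The one dimensional simple module `V(r)`: `a` and `d` act as `0`, `b` and `c` act as the
scalar `(-1)^r`. -/
def V (k : Type u) [Field k] (r : ZMod 2) : FDMod k (D4 k) := { carrier := VCarrier k r }

/-- `P(r)`, the projective cover of `V(r)`. -/
def P (k : Type u) [Field k] (r : ZMod 2) : FDMod k (D4 k) := (V k r).projCover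

end D4

end

/-! The element bc is central and acts as 1 on V(r), so everything takes place where bc = 1. There b
= c and the last relation becomes da = -ad: a module is a ℤ/2-graded module over the exterior
algebra on a and d, graded by the eigenvalues of b. Hence P(r) has basis p, ap, dp, adp with socle
spanned by adp, and it is injective as well as projective.

The minimal resolutions can then be written down. Ω^s V(r) has a basis x_0, …, x_s of sign
(-1)^(r+s) and y_1, …, y_s of the opposite sign, with a x_i = y_{i+1}, d x_i = y_i and y_0 = y_{s+1}
= 0. Ω^{-s} V(r) has x_0, …, x_{s-1} and y_0, …, y_s with the same formulas, and now the y_i have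
sign (-1)^(r+s) (`nonempty_syzygy_equiv`, `nonempty_cosyzygy_equiv`).

In a tensor product of two such modules, ad(x_i ⊗ x'_j) = ±(y_i ⊗ y'_{j+1} - y_{i+1} ⊗ y'_j)
(`ad_smul_tmk`). For syzygies y_0 = 0, so telescoping writes each of the st vectors y_i ⊗ y'_j as ad
w, where w generates a copy of P, while the sums of x_i ⊗ x'_j over i + j = n generate Ω^{s+t}. For
cosyzygies the st vectors x_i ⊗ x'_j generate the copies of P, and a lattice path of vectors y_i ⊗
y'_j carries Ω^{-(s+t)}. In both cases independence of socle vectors makes the map from the direct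
sum injective, and (2s+1)(2t+1) = 2(s+t) + 1 + 4st makes it bijective (`nonempty_equiv_prod`). The
generators of the projective summands have sign (-1)^(r+r'+s+t), whence the dependence on the parity
of s + t. -/

noncomputable section

/-! ### Uniqueness of projective covers and injective envelopes -/

section Uniqueness

variable {A : Type u} [Ring A]

/-- A lift f of π through π' is onto because ker π' is superfluous. Projectivity gives a section g
of f; it too lies over M, so it is onto because ker π is superfluous, and then f is injective. -/
theorem IsProjectiveCover.exists_equiv {M P P' : Type u} [AddCommGroup M] [Module A M]
    [AddCommGroup P] [Module A P] [AddCommGroup P'] [Module A P']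
    {π : P →ₗ[A] M} {π' : P' →ₗ[A] M} (h : IsProjectiveCover π) (h' : IsProjectiveCover π') :
    ∃ e : P ≃ₗ[A] P', ∀ x, π' (e x) = π x := by
  have := h.projective
  have := h'.projective
  obtain ⟨f, hf⟩ := Module.projective_lifting_property π' π h'.surjective
  have hf' : ∀ x, π' (f x) = π x := fun x => LinearMap.congr_fun hf x
  have sup : ∀ {X Y : Type u} [AddCommGroup X] [Module A X] [AddCommGroup Y] [Module A Y]
      (p : X →ₗ[A] M) (q : Y →ₗ[A] M) (g : X →ₗ[A] Y), Function.Surjective p →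
      (∀ x, q (g x) = p x) → LinearMap.range g ⊔ LinearMap.ker q = ⊤ := by
    intro X Y _ _ _ _ p q g hp hg
    rw [eq_top_iff]
    intro y _
    obtain ⟨x, hx⟩ := hp (q y)
    exact Submodule.mem_sup.2 ⟨g x, ⟨x, rfl⟩, y - g x, by simp [hg, hx], by abel⟩
  have hsurj : Function.Surjective f :=
    LinearMap.range_eq_top.1 (h'.superfluous _ (sup π π' f h.surjective hf'))
  obtain ⟨g, hg⟩ := Module.projective_lifting_property f LinearMap.id hsurj
  have hg' : ∀ x, f (g x) = x := fun x => LinearMap.congr_fun hg x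
  have gsurj : Function.Surjective g :=
    LinearMap.range_eq_top.1 (h.superfluous _ (sup π' π g h'.surjective fun x => by
      rw [← hf', hg']))
  have hinj : Function.Injective f := fun x y hxy => by
    obtain ⟨x, rfl⟩ := gsurj x
    obtain ⟨y, rfl⟩ := gsurj y
    rw [hg', hg'] at hxy
    rw [hxy]
  exact ⟨LinearEquiv.ofBijective f ⟨hinj, hsurj⟩, hf'⟩

/-- Dual argument: an extension f of ι' along ι is injective because the image of ι is essential,
and a retraction g of f is injective because the image of ι' is; hence f is onto. -/
theorem IsInjectiveEnvelope.exists_equiv {M I I' : Type u} [AddCommGroup M] [Module A M]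
    [AddCommGroup I] [Module A I] [AddCommGroup I'] [Module A I']
    {ι : M →ₗ[A] I} {ι' : M →ₗ[A] I'} (h : IsInjectiveEnvelope ι) (h' : IsInjectiveEnvelope ι') :
    ∃ e : I ≃ₗ[A] I', ∀ x, e (ι x) = ι' x := by
  have inf : ∀ {X Y : Type u} [AddCommGroup X] [Module A X] [AddCommGroup Y] [Module A Y]
      (p : M →ₗ[A] X) (q : M →ₗ[A] Y) (g : X →ₗ[A] Y), Function.Injective q →
      (∀ x, g (p x) = q x) → LinearMap.ker g ⊓ LinearMap.range p = ⊥ := by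
    intro X Y _ _ _ _ p q g hq hg
    rw [eq_bot_iff]
    rintro _ ⟨hx, m, rfl⟩
    have hx' : g (p m) = 0 := hx
    rw [hg] at hx'
    rw [hq (hx'.trans (map_zero q).symm), map_zero]
    exact zero_mem _
  obtain ⟨f, hf⟩ := h'.injectiveModule.out ι h.injective ι'
  have finj : Function.Injective f :=
    LinearMap.ker_eq_bot.1 (h.essential _ (inf ι ι' f h'.injective hf))
  obtain ⟨g, hg⟩ := h.injectiveModule.out f finj LinearMap.id
  have ginj : Function.Injective g :=
    LinearMap.ker_eq_bot.1 (h'.essential _ (inf ι' ι g h.injective fun x => by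
      rw [← hf, hg]; rfl))
  have hsurj : Function.Surjective f := fun y => ⟨g y, ginj (hg (g y))⟩
  exact ⟨LinearEquiv.ofBijective f ⟨finj, hsurj⟩, hf⟩

theorem IsProjectiveCover.comp_equiv {M M' P : Type u} [AddCommGroup M] [Module A M]
    [AddCommGroup M'] [Module A M'] [AddCommGroup P] [Module A P]
    {π : P →ₗ[A] M} (h : IsProjectiveCover π) (e : M ≃ₗ[A] M') :
    IsProjectiveCover (e.toLinearMap ∘ₗ π) where
  projective := h.projective
  surjective := e.surjective.comp h.surjective
  superfluous N hN := h.superfluous N (by rwa [LinearEquiv.ker_comp] at hN)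

theorem IsInjectiveEnvelope.comp_equiv {M M' I : Type u} [AddCommGroup M] [Module A M]
    [AddCommGroup M'] [Module A M'] [AddCommGroup I] [Module A I]
    {ι : M →ₗ[A] I} (h : IsInjectiveEnvelope ι) (e : M' ≃ₗ[A] M) :
    IsInjectiveEnvelope (ι ∘ₗ e.toLinearMap) where
  injectiveModule := h.injectiveModule
  injective := h.injective.comp e.injective
  essential N hN := h.essential N (by rwa [LinearEquiv.range_comp] at hN)

variable {k : Type u} [Field k] [Algebra k A] [Module.Finite k A]

/-- The syzygy may be computed by any short exact sequence `0 → K → P → M → 0` in which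
`P → M` is a projective cover. -/
theorem nonempty_syzygyOne_equiv (M : FDMod k A) {P K M' : Type u} [AddCommGroup P] [Module A P]
    [AddCommGroup K] [Module A K] [AddCommGroup M'] [Module A M']
    {π : P →ₗ[A] M'} (h : IsProjectiveCover π) (e : M' ≃ₗ[A] M) (j : K →ₗ[A] P)
    (hj : Function.Injective j) (hjπ : LinearMap.range j = LinearMap.ker π) :
    Nonempty (M.syzygyOne ≃ₗ[A] K) := by
  obtain ⟨f, hf⟩ := (h.comp_equiv e).exists_equiv M.isProjectiveCover_projCoverMap
  have h1 : (LinearMap.ker π).map f.toLinearMap = LinearMap.ker M.projCoverMap := by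
    ext x
    constructor
    · rintro ⟨y, hy, rfl⟩
      have hy' : π y = 0 := hy
      change M.projCoverMap (f y) = 0
      rw [hf]
      simp [hy']
    · intro hx
      refine ⟨f.symm x, ?_, by simp⟩
      have := hf (f.symm x)
      rw [LinearEquiv.apply_symm_apply, LinearMap.mem_ker.1 hx] at this
      have h2 : e (π (f.symm x)) = 0 := this.symm
      exact (LinearEquiv.map_eq_zero_iff e).1 h2
  exact ⟨((LinearEquiv.ofInjective j hj).trans ((LinearEquiv.ofEq _ _ hjπ).trans
    ((f.submoduleMap (LinearMap.ker π)).trans (LinearEquiv.ofEq _ _ h1)))).symm⟩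

/-- The cosyzygy may be computed by any short exact sequence `0 → M → I → C → 0` in which
`M → I` is an injective envelope. -/
theorem nonempty_cosyzygyOne_equiv (M : FDMod k A) {I C M' : Type u} [AddCommGroup I] [Module A I]
    [AddCommGroup C] [Module A C] [AddCommGroup M'] [Module A M']
    {ι : M' →ₗ[A] I} (h : IsInjectiveEnvelope ι) (e : M ≃ₗ[A] M') (q : I →ₗ[A] C)
    (hq : Function.Surjective q) (hιq : LinearMap.range ι = LinearMap.ker q) :
    Nonempty (M.cosyzygyOne ≃ₗ[A] C) := by
  obtain ⟨f, hf⟩ := M.isInjectiveEnvelope_injEnvelopeMap.exists_equiv (h.comp_equiv e)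
  have h1 : (LinearMap.range M.injEnvelopeMap).map f.toLinearMap = LinearMap.ker q := by
    rw [← hιq]
    ext x
    constructor
    · rintro ⟨_, ⟨m, rfl⟩, rfl⟩
      exact ⟨e m, (hf m).symm⟩
    · rintro ⟨m, rfl⟩
      refine ⟨M.injEnvelopeMap (e.symm m), ⟨_, rfl⟩, ?_⟩
      change f _ = _
      rw [hf]
      simp
  exact ⟨(Submodule.Quotient.equiv _ _ f h1).trans (q.quotKerEquivOfSurjective hq)⟩

theorem nonempty_projCover_equiv (M : FDMod k A) {P M' : Type u} [AddCommGroup P] [Module A P]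
    [AddCommGroup M'] [Module A M'] {π : P →ₗ[A] M'} (h : IsProjectiveCover π) (e : M' ≃ₗ[A] M) :
    Nonempty (M.projCover ≃ₗ[A] P) := by
  obtain ⟨f, -⟩ := (h.comp_equiv e).exists_equiv M.isProjectiveCover_projCoverMap
  exact ⟨f.symm⟩

end Uniqueness

namespace D4

variable {k : Type u} [Field k]

theorem induction_on {p : D4 k → Prop} (x : D4 k) (hs : ∀ z : k, p (algebraMap k _ z))
    (hg : ∀ g, p (gen k g)) (hadd : ∀ x y, p x → p y → p (x + y))
    (hmul : ∀ x y, p x → p y → p (x * y)) : p x := by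
  obtain ⟨x, rfl⟩ := mk_surjective k x
  induction x using FreeAlgebra.induction with
  | grade0 r => rw [AlgHom.commutes]; exact hs r
  | grade1 g => exact hg g
  | mul x y hx hy => rw [map_mul]; exact hmul _ _ hx hy
  | add x y hx hy => rw [map_add]; exact hadd _ _ hx hy

/-! ### Linear maps commuting with the generators -/

section Hom

variable {M N : Type u} [AddCommGroup M] [Module k M] [Module (D4 k) M]
  [IsScalarTower k (D4 k) M] [AddCommGroup N] [Module k N] [Module (D4 k) N]
  [IsScalarTower k (D4 k) N]

/-- A `k`-linear map that commutes with the generators is `D₄`-linear. -/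
def homOfGen (f : M →ₗ[k] N) (h : ∀ g m, f (gen k g • m) = gen k g • f m) :
    M →ₗ[D4 k] N where
  toFun := f
  map_add' := f.map_add
  map_smul' x := by
    have : ∀ m, f (x • m) = x • f m := by
      induction x using induction_on with
      | hs z => intro m; rw [algebraMap_smul, algebraMap_smul, map_smul]
      | hg g => exact h g
      | hadd x y hx hy => intro m; rw [add_smul, add_smul, map_add, hx, hy]
      | hmul x y hx hy => intro m; rw [mul_smul, mul_smul, hx, hy]
    exact this

@[simp] theorem homOfGen_apply (f : M →ₗ[k] N) (h : ∀ g m, f (gen k g • m) = gen k g • f m)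
    (m : M) : homOfGen f h m = f m := rfl

theorem gen_smul_smul (g : D4Gen) (z : k) (m : M) : gen k g • z • m = z • gen k g • m :=
  smul_algebra_smul_comm z (gen k g) m

end Hom

/-! ### Radical and socle where bc = 1 -/

section Action

variable {M N : Type u} [AddCommGroup M] [Module (D4 k) M] [AddCommGroup N] [Module (D4 k) N]

theorem aa_smul (m : M) : gen k .a • gen k .a • m = 0 := by rw [← mul_smul, aa, zero_smul]
theorem dd_smul (m : M) : gen k .d • gen k .d • m = 0 := by rw [← mul_smul, dd, zero_smul]
theorem ba_smul (m : M) : gen k .b • gen k .a • m = -(gen k .a • gen k .b • m) := by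
  rw [← mul_smul, ba, neg_smul, mul_smul]
theorem ca_smul (m : M) : gen k .c • gen k .a • m = -(gen k .a • gen k .c • m) := by
  rw [← mul_smul, ca, neg_smul, mul_smul]
theorem bd_smul (m : M) : gen k .b • gen k .d • m = -(gen k .d • gen k .b • m) := by
  rw [← mul_smul, ← mul_smul, db, neg_smul, neg_neg]
theorem cd_smul (m : M) : gen k .c • gen k .d • m = -(gen k .d • gen k .c • m) := by
  rw [← mul_smul, ← mul_smul, dc, neg_smul, neg_neg]

/-- The defect 1 - bc in the last relation kills m, so a and d anticommute on it. -/
theorem da_smul {m : M} (hm : gen k .b • gen k .c • m = m) :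
    gen k .d • gen k .a • m = -(gen k .a • gen k .d • m) := by
  have : (gen k .d * gen k .a + gen k .a * gen k .d) • m = 0 := by
    rw [da, sub_smul, one_smul, mul_smul, hm, sub_self]
  rw [add_smul, mul_smul, mul_smul] at this
  exact eq_neg_of_add_eq_zero_left this

/-- In the principal block a homomorphism is injective if it is injective on the vectors that
are annihilated by `a` and `d`. -/
theorem injective_of_socle (hM : ∀ m : M, gen k .b • gen k .c • m = m) (f : M →ₗ[D4 k] N)
    (hf : ∀ m, gen k .a • m = 0 → gen k .d • m = 0 → f m = 0 → m = 0) :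
    Function.Injective f := by
  rw [← LinearMap.ker_eq_bot, eq_bot_iff]
  intro m hm
  have hm' : f m = 0 := hm
  -- The kernel is stable under a and d. The vectors adm, am, dm, m vanish in this order, each being
  -- annihilated by a and d once the earlier ones are zero.
  have h1 : gen k .a • gen k .d • m = 0 :=
    hf _ (aa_smul _) (by rw [da_smul (hM _), dd_smul, smul_zero, neg_zero]) (by simp [hm'])
  have h2 : gen k .a • m = 0 :=
    hf _ (aa_smul _) (by rw [da_smul (hM _), h1, neg_zero]) (by simp [hm'])
  have h3 : gen k .d • m = 0 := hf _ h1 (dd_smul _) (by simp [hm'])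
  exact hf _ h2 h3 hm'

/-- Nakayama's lemma for the radical aM + dM, whose cube is zero: substituting m = l + ap + dq puts
adM in L, then aM and dM, then M. It yields the superfluous kernels. -/
theorem eq_top_of_sup_eq_top (hM : ∀ m : M, gen k .b • gen k .c • m = m)
    {K L : Submodule (D4 k) M} (hK : ∀ m ∈ K, ∃ p q : M, m = gen k .a • p + gen k .d • q)
    (h : L ⊔ K = ⊤) : L = ⊤ := by
  have key : ∀ m : M, ∃ l ∈ L, ∃ p q : M, m = l + (gen k .a • p + gen k .d • q) := by
    intro m
    have hm : m ∈ L ⊔ K := h ▸ Submodule.mem_top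
    obtain ⟨l, hl, x, hx, rfl⟩ := Submodule.mem_sup.1 hm
    obtain ⟨p, q, rfl⟩ := hK x hx
    exact ⟨l, hl, p, q, rfl⟩
  have h1 : ∀ m : M, gen k .a • gen k .d • m ∈ L := by
    intro m
    obtain ⟨l, hl, p, q, rfl⟩ := key m
    have : gen k .a • gen k .d • (l + (gen k .a • p + gen k .d • q)) = gen k .a • gen k .d • l := by
      simp only [smul_add, dd_smul, da_smul (hM p), smul_neg, aa_smul, neg_zero, add_zero]
    rw [this]
    exact L.smul_mem _ (L.smul_mem _ hl)
  have h2 : ∀ m : M, gen k .a • m ∈ L := by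
    intro m
    obtain ⟨l, hl, p, q, rfl⟩ := key m
    rw [smul_add, smul_add, aa_smul, zero_add]
    exact add_mem (L.smul_mem _ hl) (h1 q)
  have h3 : ∀ m : M, gen k .d • m ∈ L := by
    intro m
    obtain ⟨l, hl, p, q, rfl⟩ := key m
    rw [smul_add, smul_add, dd_smul, add_zero, da_smul (hM p)]
    exact add_mem (L.smul_mem _ hl) (neg_mem (h1 p))
  rw [eq_top_iff]
  intro m _
  obtain ⟨l, hl, p, q, rfl⟩ := key m
  exact add_mem hl (add_mem (h2 p) (h3 q))

/-- The map M → M/L is injective on the vectors killed by a and d, since these lie in K and L meets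
K trivially; so it is injective on M and its kernel L is zero. It yields the essential images. -/
theorem eq_bot_of_inf_eq_bot (hM : ∀ m : M, gen k .b • gen k .c • m = m)
    {K L : Submodule (D4 k) M} (hK : ∀ m : M, gen k .a • m = 0 → gen k .d • m = 0 → m ∈ K)
    (h : L ⊓ K = ⊥) : L = ⊥ := by
  have := injective_of_socle (M := M) hM L.mkQ fun m h1 h2 h3 => by
    have : m ∈ L ⊓ K := ⟨(Submodule.Quotient.mk_eq_zero L).1 h3, hK m h1 h2⟩
    rwa [h, Submodule.mem_bot] at this
  rw [← L.ker_mkQ]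
  exact LinearMap.ker_eq_bot.2 this

end Action

theorem sign_add (r r' : ZMod 2) : sign k (r + r') = sign k r * sign k r' := by
  revert r r'
  have : ∀ n : ZMod 2, n = 0 ∨ n = 1 := by decide
  intro r r'
  rcases this r with rfl | rfl <;> rcases this r' with rfl | rfl <;>
    simp [sign, show (1 + 1 : ZMod 2) = 0 from rfl, ZMod.val_one]

theorem sign_add_one (r : ZMod 2) : sign k (r + 1) = -sign k r := by
  rw [sign_add]
  simp [sign, ZMod.val_one]

/-- The module over `D₄` defined by four operators that satisfy the defining relations. -/
abbrev moduleOf {W : Type u} [AddCommGroup W] [Module k W] {a b c d : Module.End k W}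
    (h : Satisfies a b c d) : Module (D4 k) W :=
  Module.compHom W (lift (k := k) h).toRingHom

theorem isScalarTower_moduleOf {W : Type u} [AddCommGroup W] [Module k W]
    {a b c d : Module.End k W} (h : Satisfies a b c d) :
    letI := moduleOf h; IsScalarTower k (D4 k) W :=
  letI := moduleOf h
  { smul_assoc := fun z x w => by
      change lift (k := k) h (z • x) w = z • lift (k := k) h x w
      rw [map_smul]; rfl }

theorem gen_smul_moduleOf {W : Type u} [AddCommGroup W] [Module k W]
    {a b c d : Module.End k W} (h : Satisfies a b c d) (g : D4Gen) (w : W) :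
    letI := moduleOf h; gen k g • w = onGen a b c d g w := by
  change lift (k := k) h (gen k g) w = _
  rw [lift_gen]

/-! ### A model of `P(r)` -/

/-- The coordinate space of `P(r)`: `(α, β, γ, δ)` stands for `α p + β a p + γ d p + δ a d p`. -/
def QCarrier (k : Type u) (_r : ZMod 2) : Type u := k × k × k × k

namespace QCarrier

variable {r : ZMod 2}

instance : AddCommGroup (QCarrier k r) := inferInstanceAs (AddCommGroup (k × k × k × k))
instance : Module k (QCarrier k r) := inferInstanceAs (Module k (k × k × k × k))
instance : Module.Finite k (QCarrier k r) := inferInstanceAs (Module.Finite k (k × k × k × k))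

/-- The element of the model with given coordinates. -/
def of (r : ZMod 2) (α β γ δ : k) : QCarrier k r := (α, β, γ, δ)

/-- The coefficient at `p`. -/
def co0 : QCarrier k r →ₗ[k] k := LinearMap.fst k k (k × k × k)
/-- The coefficient at `a p`. -/
def co1 : QCarrier k r →ₗ[k] k :=
  (LinearMap.fst k k (k × k)).comp (LinearMap.snd k k (k × k × k))
/-- The coefficient at `d p`. -/
def co2 : QCarrier k r →ₗ[k] k :=
  (LinearMap.fst k k k).comp ((LinearMap.snd k k (k × k)).comp (LinearMap.snd k k (k × k × k)))
/-- The coefficient at `a d p`. -/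
def co3 : QCarrier k r →ₗ[k] k :=
  (LinearMap.snd k k k).comp ((LinearMap.snd k k (k × k)).comp (LinearMap.snd k k (k × k × k)))

@[simp] theorem co0_of (α β γ δ : k) : co0 (of r α β γ δ) = α := rfl
@[simp] theorem co1_of (α β γ δ : k) : co1 (of r α β γ δ) = β := rfl
@[simp] theorem co2_of (α β γ δ : k) : co2 (of r α β γ δ) = γ := rfl
@[simp] theorem co3_of (α β γ δ : k) : co3 (of r α β γ δ) = δ := rfl

@[ext] theorem ext {x y : QCarrier k r} (h0 : co0 x = co0 y) (h1 : co1 x = co1 y)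
    (h2 : co2 x = co2 y) (h3 : co3 x = co3 y) : x = y :=
  Prod.ext h0 (Prod.ext h1 (Prod.ext h2 h3))

/-- The action of `a`. -/
def opA : Module.End k (QCarrier k r) where
  toFun x := of r 0 (co0 x) 0 (co2 x)
  map_add' x y := by ext <;> simp
  map_smul' z x := by ext <;> simp

/-- The action of `b` and of `c`. -/
def opB : Module.End k (QCarrier k r) where
  toFun x := sign k r • of r (co0 x) (-co1 x) (-co2 x) (co3 x)
  map_add' x y := by ext <;> simp <;> ring
  map_smul' z x := by ext <;> simp <;> ring

/-- The action of `d`. -/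
def opD : Module.End k (QCarrier k r) where
  toFun x := of r 0 0 (co0 x) (-co1 x)
  map_add' x y := by ext <;> simp; ring
  map_smul' z x := by ext <;> simp

theorem satisfies : Satisfies (B := Module.End k (QCarrier k r)) opA opB opB opD where
  ba := by ext x <;> simp [opA, opB]
  db := by ext x <;> simp [opD, opB]
  ca := by ext x <;> simp [opA, opB]
  dc := by ext x <;> simp [opD, opB]
  bc := rfl
  aa := by ext x <;> simp [opA]
  bb := by ext x <;> simp [opB, ← mul_assoc, sign_mul_self]
  cc := by ext x <;> simp [opB, ← mul_assoc, sign_mul_self]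
  dd := by ext x <;> simp [opD]
  da := by ext x <;> simp [opA, opB, opD, ← mul_assoc, sign_mul_self]

instance : Module (D4 k) (QCarrier k r) := moduleOf satisfies
instance : IsScalarTower k (D4 k) (QCarrier k r) := isScalarTower_moduleOf satisfies

theorem a_smul (x : QCarrier k r) : gen k .a • x = of r 0 (co0 x) 0 (co2 x) :=
  gen_smul_moduleOf satisfies .a x
theorem b_smul (x : QCarrier k r) :
    gen k .b • x = sign k r • of r (co0 x) (-co1 x) (-co2 x) (co3 x) :=
  gen_smul_moduleOf satisfies .b x
theorem c_smul (x : QCarrier k r) :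
    gen k .c • x = sign k r • of r (co0 x) (-co1 x) (-co2 x) (co3 x) :=
  gen_smul_moduleOf satisfies .c x
theorem d_smul (x : QCarrier k r) : gen k .d • x = of r 0 0 (co0 x) (-co1 x) :=
  gen_smul_moduleOf satisfies .d x

theorem bc_smul (x : QCarrier k r) : gen k .b • gen k .c • x = x := by
  ext <;> simp [b_smul, c_smul, ← mul_assoc, sign_mul_self]

variable {M : Type u} [AddCommGroup M] [Module k M] [Module (D4 k) M] [IsScalarTower k (D4 k) M]

/-- The homomorphism from the model of `P(r)` that takes the generator to `w`. -/
def toModule (w : M) (hb : gen k .b • w = sign k r • w) (hc : gen k .c • w = sign k r • w) :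
    QCarrier k r →ₗ[D4 k] M :=
  homOfGen (co0.smulRight w + co1.smulRight (gen k .a • w) + co2.smulRight (gen k .d • w)
      + co3.smulRight (gen k .a • gen k .d • w)) (by
    have hbc : gen k .b • gen k .c • w = w := by
      rw [hc, gen_smul_smul, hb, smul_smul, sign_mul_self, one_smul]
    -- Anticommutation is applied to dw, which bc fixes because b and c each change sign when moved
    -- past d.
    have hdad : gen k .d • gen k .a • gen k .d • w = 0 := by
      rw [da_smul (by rw [cd_smul, smul_neg, bd_smul, neg_neg, hbc]), dd_smul, smul_zero, neg_zero]
    rintro (_ | _ | _ | _) m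
    · simp [a_smul, smul_add, gen_smul_smul, aa_smul]
    · simp [b_smul, smul_add, gen_smul_smul, ba_smul, bd_smul, hb, smul_smul (M := k), mul_comm]
    · simp [c_smul, smul_add, gen_smul_smul, ca_smul, cd_smul, hc, smul_smul (M := k), mul_comm]
    · simp [d_smul, smul_add, gen_smul_smul, dd_smul, da_smul hbc, hdad])

theorem toModule_apply (w : M) (hb : gen k .b • w = sign k r • w)
    (hc : gen k .c • w = sign k r • w) (x : QCarrier k r) :
    toModule w hb hc x = co0 x • w + co1 x • gen k .a • w + co2 x • gen k .d • w
      + co3 x • gen k .a • gen k .d • w := rfl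

/-- The generator `p`. -/
def top (r : ZMod 2) : QCarrier k r := of r 1 0 0 0

theorem b_smul_top : gen k .b • (top r : QCarrier k r) = sign k r • top r := by
  ext <;> simp [top, b_smul]
theorem c_smul_top : gen k .c • (top r : QCarrier k r) = sign k r • top r := by
  ext <;> simp [top, c_smul]

/-- The idempotent `(1 + σ b)(1 + σ c) / 4`, where `σ = (-1)^r`. -/
def idem (k : Type u) [Field k] (r : ZMod 2) : D4 k :=
  ((2 : k)⁻¹ * (2 : k)⁻¹) • ((1 + sign k r • gen k .b) * (1 + sign k r • gen k .c))

theorem b_mul_idem : gen k .b * idem k r = sign k r • idem k r := by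
  have : gen k .b * (1 + sign k r • gen k .b) = sign k r • (1 + sign k r • gen k .b) := by
    simp [mul_add, bb, smul_smul, sign_mul_self, add_comm]
  rw [idem, mul_smul_comm, ← mul_assoc, this, smul_mul_assoc, smul_comm]

theorem idem_eq : idem k r =
    ((2 : k)⁻¹ * (2 : k)⁻¹) • ((1 + sign k r • gen k .c) * (1 + sign k r • gen k .b)) := by
  rw [idem]
  simp [mul_add, add_mul, bc]
  abel

theorem c_mul_idem : gen k .c * idem k r = sign k r • idem k r := by
  have : gen k .c * (1 + sign k r • gen k .c) = sign k r • (1 + sign k r • gen k .c) := by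
    simp [mul_add, cc, smul_smul, sign_mul_self, add_comm]
  rw [idem_eq, mul_smul_comm, ← mul_assoc, this, smul_mul_assoc, smul_comm]

theorem idem_mul_b : idem k r * gen k .b = sign k r • idem k r := by
  have : (1 + sign k r • gen k .b) * gen k .b = sign k r • (1 + sign k r • gen k .b) := by
    simp [add_mul, bb, smul_smul, sign_mul_self, add_comm]
  rw [idem_eq, smul_mul_assoc, mul_assoc, this, mul_smul_comm, smul_comm]

theorem idem_mul_c : idem k r * gen k .c = sign k r • idem k r := by
  have : (1 + sign k r • gen k .c) * gen k .c = sign k r • (1 + sign k r • gen k .c) := by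
    simp [add_mul, cc, smul_smul, sign_mul_self, add_comm]
  rw [idem, smul_mul_assoc, mul_assoc, this, mul_smul_comm, smul_comm]

theorem idem_smul {M : Type u} [AddCommGroup M] [Module k M] [Module (D4 k) M]
    [IsScalarTower k (D4 k) M] (hk : (2 : k) ≠ 0) (w : M) (hb : gen k .b • w = sign k r • w)
    (hc : gen k .c • w = sign k r • w) : idem k r • w = w := by
  have hb' : (1 + sign k r • gen k .b) • w = (2 : k) • w := by
    rw [add_smul, one_smul, smul_assoc, hb, smul_smul, sign_mul_self, one_smul, two_smul]
  have hc' : (1 + sign k r • gen k .c) • w = (2 : k) • w := by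
    rw [add_smul, one_smul, smul_assoc, hc, smul_smul, sign_mul_self, one_smul, two_smul]
  rw [idem, smul_assoc, mul_smul (_ + _), hc', smul_algebra_smul_comm, hb', smul_smul (2 : k) 2,
    smul_smul]
  rw [show (2 : k)⁻¹ * 2⁻¹ * (2 * 2) = 1 by field_simp, one_smul]

theorem hom_ext {f g : QCarrier k r →ₗ[D4 k] M} (h : f (top r) = g (top r)) : f = g := by
  have key : ∀ x : QCarrier k r, x = co0 x • top r + co1 x • gen k .a • top r
      + co2 x • gen k .d • top r + co3 x • gen k .a • gen k .d • top r := by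
    intro x
    ext <;> simp [top, a_smul, d_smul]
  have hs : ∀ (f : QCarrier k r →ₗ[D4 k] M) (z : k) x, f (z • x) = z • f x := fun f z x => by
    rw [← algebraMap_smul (D4 k) z x, map_smul, algebraMap_smul]
  ext x
  rw [key x]
  simp only [map_add, hs, map_smul, h]

/-- P(r) is a direct summand of D₄: p ↦ e embeds it, for the idempotent e of weight r, and x ↦ x p
is a retraction because e p = p. Division by 4 in e is where char k ≠ 2 enters. -/
theorem projective (hk : (2 : k) ≠ 0) : Module.Projective (D4 k) (QCarrier k r) :=
  Module.Projective.of_split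
    (toModule (M := D4 k) (k := k) (r := r) (idem k r) (b_mul_idem (k := k)) (c_mul_idem (k := k)))
    (LinearMap.toSpanSingleton (D4 k) (QCarrier k r) (top r))
    (hom_ext (by
      have h : toModule (M := D4 k) (k := k) (r := r) (idem k r) (b_mul_idem (k := k))
          (c_mul_idem (k := k)) (top r) = idem k r := by
        simp [toModule_apply, top]
      rw [LinearMap.comp_apply, h, LinearMap.toSpanSingleton_apply, LinearMap.id_apply,
        idem_smul hk _ b_smul_top c_smul_top]))

/-- The vector adp has the same sign as p, so e preserves the coordinate along it. -/
theorem co3_idem_smul (hk : (2 : k) ≠ 0) (x : QCarrier k r) : co3 (idem k r • x) = co3 x := by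
  have hb : ∀ x : QCarrier k r, co3 ((1 + sign k r • gen k .b) • x) = 2 * co3 x := fun x => by
    rw [add_smul, one_smul, smul_assoc, b_smul]
    simp [← mul_assoc, sign_mul_self, two_mul]
  have hc : ∀ x : QCarrier k r, co3 ((1 + sign k r • gen k .c) • x) = 2 * co3 x := fun x => by
    rw [add_smul, one_smul, smul_assoc, c_smul]
    simp [← mul_assoc, sign_mul_self, two_mul]
  rw [idem, smul_assoc, mul_smul (_ + _), map_smul, hb, hc, smul_eq_mul]
  field_simp

theorem idem_mul_a_mul_a : idem k r * gen k .a * gen k .a = 0 := by rw [mul_assoc, aa, mul_zero]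

/-- Since e bc = e, the term 1 - bc of the last relation disappears after multiplication by e on the
left. -/
theorem idem_mul_d_mul_a :
    idem k r * gen k .d * gen k .a = -(idem k r * gen k .a * gen k .d) := by
  rw [mul_assoc, eq_sub_of_add_eq da, mul_sub, mul_sub, ← mul_assoc, ← mul_assoc, idem_mul_b,
    smul_mul_assoc, idem_mul_c, smul_smul, sign_mul_self, mul_one, one_smul, sub_self, zero_sub]

theorem idem_mul_a_mul_d_mul_a : idem k r * gen k .a * gen k .d * gen k .a = 0 := by
  rw [← neg_eq_iff_eq_neg.2 (idem_mul_d_mul_a (k := k) (r := r)), neg_mul, mul_assoc, aa,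
    mul_zero, neg_zero]

/-- Evaluation of the elements of the coinduced module. -/
def evalAt (k : Type u) [Field k] : D4 k →ₗ[k] Coind k (D4 k) k →ₗ[k] k :=
  LinearMap.mk₂ k (fun y φ => (show D4 k →ₗ[k] k from φ) y)
    (fun x y (φ : D4 k →ₗ[k] k) => map_add φ x y) (fun z y (φ : D4 k →ₗ[k] k) => map_smul φ z y)
    (fun y (φ ψ : D4 k →ₗ[k] k) => LinearMap.add_apply φ ψ y)
    (fun z y (φ : D4 k →ₗ[k] k) => LinearMap.smul_apply z φ y)

theorem evalAt_smul (x y : D4 k) (φ : Coind k (D4 k) k) :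
    evalAt k y (x • φ) = evalAt k (y * x) φ := rfl

/-- The homomorphism from the coinduced module to `P(r)` that takes the value at the idempotent
to the socle. -/
def retract (k : Type u) [Field k] (r : ZMod 2) : Coind k (D4 k) k →ₗ[D4 k] QCarrier k r :=
  homOfGen
    -- These values recover x from the functional y ↦ `co3 (y • x)`: the adp-coordinates of adx, dx,
    -- ax and x are `co0 x`, `-co1 x`, `co2 x` and `co3 x`.
    { toFun := fun φ => of r (evalAt k (idem k r * gen k .a * gen k .d) φ)
        (-evalAt k (idem k r * gen k .d) φ) (evalAt k (idem k r * gen k .a) φ)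
        (evalAt k (idem k r) φ)
      map_add' := fun x y => by ext <;> simp [add_comm]
      map_smul' := fun z x => by ext <;> simp } (by
    have hdb : idem k r * gen k .d * gen k .b = -(sign k r • (idem k r * gen k .d)) := by
      rw [mul_assoc, db, mul_neg, ← mul_assoc, idem_mul_b, smul_mul_assoc]
    have hdc : idem k r * gen k .d * gen k .c = -(sign k r • (idem k r * gen k .d)) := by
      rw [mul_assoc, dc, mul_neg, ← mul_assoc, idem_mul_c, smul_mul_assoc]
    have hab : idem k r * gen k .a * gen k .b = -(sign k r • (idem k r * gen k .a)) := by
      rw [mul_assoc, ← neg_eq_iff_eq_neg.2 ba, mul_neg, ← mul_assoc, idem_mul_b, smul_mul_assoc]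
    have hac : idem k r * gen k .a * gen k .c = -(sign k r • (idem k r * gen k .a)) := by
      rw [mul_assoc, ← neg_eq_iff_eq_neg.2 ca, mul_neg, ← mul_assoc, idem_mul_c, smul_mul_assoc]
    have hadb : idem k r * gen k .a * gen k .d * gen k .b
        = sign k r • (idem k r * gen k .a * gen k .d) := by
      rw [mul_assoc, db, mul_neg, ← mul_assoc, hab, neg_mul, neg_neg, smul_mul_assoc]
    have hadc : idem k r * gen k .a * gen k .d * gen k .c
        = sign k r • (idem k r * gen k .a * gen k .d) := by
      rw [mul_assoc, dc, mul_neg, ← mul_assoc, hac, neg_mul, neg_neg, smul_mul_assoc]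
    have hdd : ∀ x : D4 k, x * gen k .d * gen k .d = 0 := fun x => by rw [mul_assoc, dd, mul_zero]
    rintro (_ | _ | _ | _) φ
    · simp only [LinearMap.coe_mk, AddHom.coe_mk]
      rw [a_smul, evalAt_smul, evalAt_smul, evalAt_smul, evalAt_smul,
        idem_mul_a_mul_a, idem_mul_a_mul_d_mul_a, idem_mul_d_mul_a]
      ext <;> simp
    · simp only [LinearMap.coe_mk, AddHom.coe_mk]
      rw [b_smul, evalAt_smul, evalAt_smul, evalAt_smul, evalAt_smul,
        hadb, hdb, hab, idem_mul_b]
      ext <;> simp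
    · simp only [LinearMap.coe_mk, AddHom.coe_mk]
      rw [c_smul, evalAt_smul, evalAt_smul, evalAt_smul, evalAt_smul,
        hadc, hdc, hac, idem_mul_c]
      ext <;> simp
    · simp only [LinearMap.coe_mk, AddHom.coe_mk]
      rw [d_smul, evalAt_smul, evalAt_smul, evalAt_smul, evalAt_smul,
        hdd, hdd]
      ext <;> simp)

/-- The embedding of `P(r)` into the coinduced module. -/
def toCoind (k : Type u) [Field k] (r : ZMod 2) : QCarrier k r →ₗ[D4 k] Coind k (D4 k) k where
  toFun m := co3.comp ((LinearMap.toSpanSingleton (D4 k) (QCarrier k r) m).restrictScalars k)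
  map_add' m m' := LinearMap.ext fun y =>
    (congrArg co3 (smul_add y m m')).trans (map_add co3 _ _)
  map_smul' x m := LinearMap.ext fun y => congrArg co3 (mul_smul y x m).symm

/-- The adp-coordinate is a functional that does not vanish on the socle, as for a Frobenius form.
It embeds P(r) in the dual of D₄, and `retract` splits this embedding, so P(r) is a summand of an
injective module. -/
theorem injective (hk : (2 : k) ≠ 0) : Module.Injective (D4 k) (QCarrier k r) :=
  injective_of_split (toCoind k r) (retract k r) (fun x => by
    refine ext (x := of r (co3 ((idem k r * gen k .a * gen k .d) • x))
      (-co3 ((idem k r * gen k .d) • x)) (co3 ((idem k r * gen k .a) • x))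
      (co3 (idem k r • x))) ?_ ?_ ?_ ?_ <;>
    simp [mul_smul, co3_idem_smul hk, a_smul, d_smul]) Coind.injective

end QCarrier
/-! ### Modules of Loewy length two -/

/-- The space `U × W`, with `a` and `d` acting as two linear maps `U → W`, and `b` and `c` acting
as `(-1)^r` on `U` and as `-(-1)^r` on `W`. -/
def KCarrier {k : Type u} [Field k] (_r : ZMod 2) {U W : Type u} [AddCommGroup U] [Module k U]
    [AddCommGroup W] [Module k W] (_A _D : U →ₗ[k] W) : Type u := U × W

namespace KCarrier

variable {r : ZMod 2} {U W : Type u} [AddCommGroup U] [Module k U] [AddCommGroup W] [Module k W]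
  {A D : U →ₗ[k] W}

instance : AddCommGroup (KCarrier r A D) := inferInstanceAs (AddCommGroup (U × W))
instance : Module k (KCarrier r A D) := inferInstanceAs (Module k (U × W))
instance [Module.Finite k U] [Module.Finite k W] : Module.Finite k (KCarrier r A D) :=
  inferInstanceAs (Module.Finite k (U × W))

/-- The upper part of an element. -/
def upper : KCarrier r A D →ₗ[k] U := LinearMap.fst k U W
/-- The lower part of an element. -/
def lower : KCarrier r A D →ₗ[k] W := LinearMap.snd k U W
/-- The inclusion of the upper part. -/
def inU (r : ZMod 2) (A D : U →ₗ[k] W) : U →ₗ[k] KCarrier r A D := LinearMap.inl k U W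
/-- The inclusion of the lower part. -/
def inW (r : ZMod 2) (A D : U →ₗ[k] W) : W →ₗ[k] KCarrier r A D := LinearMap.inr k U W

@[simp] theorem upper_inU (v : U) : upper (inU r A D v) = v := rfl
@[simp] theorem lower_inU (v : U) : lower (inU r A D v) = 0 := rfl
@[simp] theorem upper_inW (w : W) : upper (inW r A D w) = 0 := rfl
@[simp] theorem lower_inW (w : W) : lower (inW r A D w) = w := rfl

@[ext] theorem ext {x y : KCarrier r A D} (h0 : upper x = upper y) (h1 : lower x = lower y) :
    x = y := Prod.ext h0 h1

/-- The action of `a` (for `E = A`) and of `d` (for `E = D`). -/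
def opE (E : U →ₗ[k] W) : Module.End k (KCarrier r A D) := (inW r A D).comp (E.comp upper)

/-- The action of `b` and of `c`. -/
def opB : Module.End k (KCarrier r A D) :=
  sign k r • ((inU r A D).comp upper - (inW r A D).comp lower)

/-- Every product of two of a, d is zero, as both map the upper part to the lower part and kill the
latter. Since bc = 1, the last relation reads 0 = 0. -/
theorem satisfies :
    Satisfies (B := Module.End k (KCarrier r A D)) (opE A) opB opB (opE D) where
  ba := by ext x <;> simp [opE, opB]
  db := by ext x <;> simp [opE, opB]
  ca := by ext x <;> simp [opE, opB]
  dc := by ext x <;> simp [opE, opB]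
  bc := rfl
  aa := by ext x <;> simp [opE]
  bb := by ext x <;> simp [opB, smul_smul, sign_mul_self]
  cc := by ext x <;> simp [opB, smul_smul, sign_mul_self]
  dd := by ext x <;> simp [opE]
  da := by ext x <;> simp [opE, opB, smul_smul, sign_mul_self]

instance : Module (D4 k) (KCarrier r A D) := moduleOf satisfies
instance : IsScalarTower k (D4 k) (KCarrier r A D) := isScalarTower_moduleOf satisfies

theorem a_smul (x : KCarrier r A D) : gen k .a • x = inW r A D (A (upper x)) :=
  gen_smul_moduleOf satisfies .a x
theorem d_smul (x : KCarrier r A D) : gen k .d • x = inW r A D (D (upper x)) :=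
  gen_smul_moduleOf satisfies .d x
theorem b_smul (x : KCarrier r A D) :
    gen k .b • x = sign k r • (inU r A D (upper x) - inW r A D (lower x)) :=
  gen_smul_moduleOf satisfies .b x
theorem c_smul (x : KCarrier r A D) :
    gen k .c • x = sign k r • (inU r A D (upper x) - inW r A D (lower x)) :=
  gen_smul_moduleOf satisfies .c x

theorem bc_smul (x : KCarrier r A D) : gen k .b • gen k .c • x = x := by
  ext <;> simp [b_smul, c_smul, smul_smul, sign_mul_self]

end KCarrier

/-- The module with basis `x_0, …, x_s, y_1, …, y_s`, `a x_i = y_{i+1}` and `d x_i = y_i`, where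
`y_0 = y_{s+1} = 0`. -/
abbrev SyzCarrier (k : Type u) [Field k] (r : ZMod 2) (s : ℕ) : Type u :=
  KCarrier r (LinearMap.funLeft k k (Fin.castSucc (n := s))) (LinearMap.funLeft k k Fin.succ)

/-- The linear map `f ↦ (0, f_0, …, f_{s-1})`. -/
def consZero (k : Type u) [Field k] (s : ℕ) : (Fin s → k) →ₗ[k] (Fin (s + 1) → k) where
  toFun f := Fin.cons 0 f
  map_add' f g := by ext i; cases i using Fin.cases <;> simp
  map_smul' z f := by ext i; cases i using Fin.cases <;> simp

/-- The linear map `f ↦ (f_0, …, f_{s-1}, 0)`. -/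
def snocZero (k : Type u) [Field k] (s : ℕ) : (Fin s → k) →ₗ[k] (Fin (s + 1) → k) where
  toFun f := Fin.snoc (α := fun _ => k) f 0
  map_add' f g := by ext i; cases i using Fin.lastCases <;> simp
  map_smul' z f := by ext i; cases i using Fin.lastCases <;> simp

@[simp] theorem consZero_zero {s : ℕ} (f : Fin s → k) : consZero k s f 0 = 0 := rfl
@[simp] theorem consZero_succ {s : ℕ} (f : Fin s → k) (i : Fin s) :
    consZero k s f i.succ = f i := rfl
@[simp] theorem snocZero_last {s : ℕ} (f : Fin s → k) : snocZero k s f (Fin.last s) = 0 := by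
  simp [snocZero]
@[simp] theorem snocZero_castSucc {s : ℕ} (f : Fin s → k) (i : Fin s) :
    snocZero k s f i.castSucc = f i := by
  simp [snocZero]

/-- The module with basis `x_0, …, x_{s-1}, y_0, …, y_s`, `a x_i = y_{i+1}` and `d x_i = y_i`. -/
abbrev CosyzCarrier (k : Type u) [Field k] (r : ZMod 2) (s : ℕ) : Type u :=
  KCarrier r (consZero k s) (snocZero k s)

/-! ### Minimal projective and injective resolutions -/

open QCarrier KCarrier

theorem bc_smul_pi {n : Type} {r : ZMod 2} (q : n → QCarrier k r) :
    gen k .b • gen k .c • q = q := funext fun i => QCarrier.bc_smul (q i)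

/-- The projective cover of `SyzCarrier k r s`. -/
def syzCover (k : Type u) [Field k] (r : ZMod 2) (s : ℕ) :
    (Fin (s + 1) → QCarrier k r) →ₗ[D4 k] SyzCarrier k r s :=
  homOfGen
    ((inU r _ _).comp (LinearMap.pi fun i => co0.comp (LinearMap.proj i)) +
      -- The generator p_i goes to x_i, so a p_i goes to y_{i+1} and d p_i to y_i. The index i of
      -- the lower part stands for y_{i+1}, which receives a p_i and d p_{i+1}.
      (inW r _ _).comp (LinearMap.pi fun i =>
        co1.comp (LinearMap.proj i.castSucc) + co2.comp (LinearMap.proj i.succ)))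
    (by
      rintro (_ | _ | _ | _) q
      · ext i <;> simp [KCarrier.a_smul, QCarrier.a_smul]
      · ext i <;> simp [KCarrier.b_smul, QCarrier.b_smul]; ring
      · ext i <;> simp [KCarrier.c_smul, QCarrier.c_smul]; ring
      · ext i <;> simp [KCarrier.d_smul, QCarrier.d_smul])

theorem upper_syzCover {r : ZMod 2} {s : ℕ} (q : Fin (s + 1) → QCarrier k r) (i : Fin (s + 1)) :
    upper (syzCover k r s q) i = co0 (q i) := by simp [syzCover]

theorem lower_syzCover {r : ZMod 2} {s : ℕ} (q : Fin (s + 1) → QCarrier k r) (i : Fin s) :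
    lower (syzCover k r s q) i = co1 (q i.castSucc) + co2 (q i.succ) := by simp [syzCover]

/-- The kernel of the projective cover of `SyzCarrier k r s`. -/
def syzKernel (k : Type u) [Field k] (r : ZMod 2) (s : ℕ) :
    SyzCarrier k (r + 1) (s + 1) →ₗ[D4 k] (Fin (s + 1) → QCarrier k r) :=
  homOfGen
    -- In terms of bases, x_j ↦ a p_{j-1} - d p_j, with p_{-1} and p_{s+1} read as 0, and y_{j+1} ↦
    -- -ad p_j.
    { toFun := fun x i => of r 0 (upper x i.succ) (-upper x i.castSucc) (-lower x i)
      map_add' := fun x y => by ext i <;> simp [-neg_add_rev, neg_add]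
      map_smul' := fun z x => by ext i <;> simp }
    (by
      rintro (_ | _ | _ | _) x
      · ext i <;> simp [KCarrier.a_smul, QCarrier.a_smul]
      · ext i <;> simp [KCarrier.b_smul, QCarrier.b_smul, sign_add_one]
      · ext i <;> simp [KCarrier.c_smul, QCarrier.c_smul, sign_add_one]
      · ext i <;> simp [KCarrier.d_smul, QCarrier.d_smul])

theorem syzKernel_apply {r : ZMod 2} {s : ℕ} (x : SyzCarrier k (r + 1) (s + 1)) (i : Fin (s + 1)) :
    syzKernel k r s x i = of r 0 (upper x i.succ) (-upper x i.castSucc) (-lower x i) := rfl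

theorem syzKernel_injective (r : ZMod 2) (s : ℕ) : Function.Injective (syzKernel k r s) := by
  rw [← LinearMap.ker_eq_bot, eq_bot_iff]
  intro x hx
  have h : ∀ i, of r 0 (upper x i.succ) (-upper x i.castSucc) (-lower x i) = 0 := fun i =>
    congrFun (LinearMap.mem_ker.1 hx) i
  rw [Submodule.mem_bot]
  ext i
  · cases i using Fin.cases with
    | zero => simpa using congrArg co2 (h 0)
    | succ i => simpa using congrArg co1 (h i)
  · simpa using congrArg co3 (h i)

theorem range_syzKernel (r : ZMod 2) (s : ℕ) :
    LinearMap.range (syzKernel k r s) = LinearMap.ker (syzCover k r s) := by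
  apply le_antisymm
  · rintro _ ⟨x, rfl⟩
    rw [LinearMap.mem_ker]
    ext i
    · simp [upper_syzCover, syzKernel_apply]
    · simp [lower_syzCover, syzKernel_apply]
  · intro q hq
    have h0 : ∀ i, co0 (q i) = 0 := fun i => by
      rw [← upper_syzCover, LinearMap.mem_ker.1 hq]; simp
    have h1 : ∀ i : Fin s, co1 (q i.castSucc) + co2 (q i.succ) = 0 := fun i => by
      rw [← lower_syzCover, LinearMap.mem_ker.1 hq]; simp
    -- The coefficient of x_0 is seen only in d p_0, that of x_{i+1} already in a p_i; agreement
    -- with the coefficient of d p_{i+1} is the kernel condition `h1`.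
    refine ⟨inU _ _ _ (Fin.cons (-co2 (q 0)) fun i => co1 (q i)) +
      inW _ _ _ (fun i => -co3 (q i)), ?_⟩
    ext i
    · simp [syzKernel_apply, h0]
    · simp [syzKernel_apply]
    · cases i using Fin.cases with
      | zero => simp [syzKernel_apply]
      | succ i =>
        simp only [syzKernel_apply, map_add, upper_inU, upper_inW, add_zero, co2_of,
          ← Fin.succ_castSucc, Fin.cons_succ]
        rw [neg_eq_iff_eq_neg, eq_neg_iff_add_eq_zero, h1]
    · simp [syzKernel_apply]

theorem syzCover_surjective (r : ZMod 2) (s : ℕ) : Function.Surjective (syzCover k r s) := by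
  intro x
  refine ⟨fun i => of r (upper x i) ((Fin.snoc (α := fun _ => k) (lower x) 0 : Fin (s + 1) → k) i)
    0 0, ?_⟩
  ext i
  · simp [upper_syzCover]
  · simp [lower_syzCover]

theorem projective_pi (hk : (2 : k) ≠ 0) {n : Type} [Finite n] (r : ZMod 2) :
    Module.Projective (D4 k) (n → QCarrier k r) := by
  have := Fintype.ofFinite n
  classical
  have := QCarrier.projective (r := r) hk
  exact Module.Projective.of_equiv' (M := Π₀ _ : n, QCarrier k r)
    (DFinsupp.linearEquivFunOnFintype (R := D4 k))

/-- Kernel vectors have no component along the generators p_i, so they lie in the radical. -/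
theorem isProjectiveCover_syzCover (hk : (2 : k) ≠ 0) (r : ZMod 2) (s : ℕ) :
    IsProjectiveCover (syzCover k r s) where
  projective := projective_pi hk r
  surjective := syzCover_surjective r s
  superfluous N hN := by
    refine eq_top_of_sup_eq_top bc_smul_pi (fun q hq => ?_) hN
    have h0 : ∀ i, co0 (q i) = 0 := fun i => by
      rw [← upper_syzCover, LinearMap.mem_ker.1 hq]; simp
    -- This is β ap + γ dp + δ adp = a(β p + δ dp) + d(γ p).
    refine ⟨fun i => of r (co1 (q i)) 0 (co3 (q i)) 0, fun i => of r (co2 (q i)) 0 0 0, ?_⟩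
    ext i <;> simp [QCarrier.a_smul, QCarrier.d_smul, h0]

/-- The injective envelope of `CosyzCarrier k (r + 1) s`. -/
def cosyzEnvelope (k : Type u) [Field k] (r : ZMod 2) (s : ℕ) :
    CosyzCarrier k (r + 1) s →ₗ[D4 k] (Fin (s + 1) → QCarrier k r) :=
  homOfGen
    -- In terms of bases, x_j ↦ -a p_j + d p_{j+1} and y_i ↦ ad p_i.
    { toFun := fun x i => of r 0 (-snocZero k s (upper x) i) (consZero k s (upper x) i) (lower x i)
      map_add' := fun x y => by ext i <;> simp [-neg_add_rev, neg_add]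
      map_smul' := fun z x => by ext i <;> simp }
    (by
      rintro (_ | _ | _ | _) x
      · ext i <;> simp [KCarrier.a_smul, QCarrier.a_smul]
      · ext i <;> simp [KCarrier.b_smul, QCarrier.b_smul, sign_add_one]
      · ext i <;> simp [KCarrier.c_smul, QCarrier.c_smul, sign_add_one]
      · ext i <;> simp [KCarrier.d_smul, QCarrier.d_smul])

theorem cosyzEnvelope_apply {r : ZMod 2} {s : ℕ} (x : CosyzCarrier k (r + 1) s) (i : Fin (s + 1)) :
    cosyzEnvelope k r s x i =
      of r 0 (-snocZero k s (upper x) i) (consZero k s (upper x) i) (lower x i) := rfl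

/-- The cokernel of the injective envelope of `CosyzCarrier k (r + 1) s`. -/
def cosyzCokernel (k : Type u) [Field k] (r : ZMod 2) (s : ℕ) :
    (Fin (s + 1) → QCarrier k r) →ₗ[D4 k] CosyzCarrier k r (s + 1) :=
  homOfGen
    -- Here p_i ↦ x_i, a p_i ↦ y_{i+1}, d p_i ↦ y_i and ad p_i ↦ 0.
    { toFun := fun q => inU r _ _ (fun i => co0 (q i)) +
        inW r _ _ (consZero k (s + 1) (fun i => co1 (q i)) + snocZero k (s + 1) fun i => co2 (q i))
      map_add' := fun x y => by
        have h : ∀ f : QCarrier k r →ₗ[k] k, (fun i => f ((x + y) i)) =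
          (fun i => f (x i)) + (fun i => f (y i)) := fun f => by ext; simp
        simp only [h, map_add]
        abel
      map_smul' := fun z x => by
        have h : ∀ f : QCarrier k r →ₗ[k] k, (fun i => f ((z • x) i)) =
          z • (fun i => f (x i)) := fun f => by ext; simp
        simp only [h, map_smul, ← smul_add, RingHom.id_apply] }
    (by
      have hn : ∀ f : Fin (s + 1) → k, (fun i => -(sign k r * f i)) = -(sign k r • f) :=
        fun f => rfl
      have h0 : (fun _ => 0 : Fin (s + 1) → k) = 0 := rfl
      rintro (_ | _ | _ | _) q
      · ext i <;> simp [KCarrier.a_smul, QCarrier.a_smul, h0]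
      · ext i <;> simp [KCarrier.b_smul, QCarrier.b_smul, hn]
      · ext i <;> simp [KCarrier.c_smul, QCarrier.c_smul, hn]
      · ext i <;> simp [KCarrier.d_smul, QCarrier.d_smul, h0])

theorem upper_cosyzCokernel {r : ZMod 2} {s : ℕ} (q : Fin (s + 1) → QCarrier k r) :
    upper (cosyzCokernel k r s q) = fun i => co0 (q i) := by simp [cosyzCokernel]

theorem lower_cosyzCokernel {r : ZMod 2} {s : ℕ} (q : Fin (s + 1) → QCarrier k r) :
    lower (cosyzCokernel k r s q) =
      consZero k (s + 1) (fun i => co1 (q i)) + snocZero k (s + 1) fun i => co2 (q i) := by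
  simp [cosyzCokernel]

theorem cosyzCokernel_surjective (r : ZMod 2) (s : ℕ) :
    Function.Surjective (cosyzCokernel k r s) := by
  intro x
  -- The vector y_{i+1} is lifted to a p_i, and y_0, which no a p_i reaches, to d p_0.
  refine ⟨fun i => of r (upper x i) (lower x i.succ)
    ((Fin.cons (lower x 0) (fun _ => 0) : Fin (s + 1) → k) i) 0, ?_⟩
  ext i
  · simp [upper_cosyzCokernel]
  · rw [lower_cosyzCokernel]
    cases i using Fin.cases with
    | zero =>
      have : (0 : Fin (s + 1 + 1)) = Fin.castSucc 0 := rfl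
      rw [Pi.add_apply, consZero_zero, this, snocZero_castSucc]
      simp
    | succ i =>
      cases i using Fin.lastCases with
      | last => rw [Pi.add_apply, consZero_succ, Fin.succ_last, snocZero_last]; simp
      | cast i =>
        rw [Pi.add_apply, consZero_succ, Fin.succ_castSucc, snocZero_castSucc]
        simp

theorem range_cosyzEnvelope (r : ZMod 2) (s : ℕ) :
    LinearMap.range (cosyzEnvelope k r s) = LinearMap.ker (cosyzCokernel k r s) := by
  apply le_antisymm
  · rintro _ ⟨x, rfl⟩
    rw [LinearMap.mem_ker]
    ext i
    · simp [upper_cosyzCokernel, cosyzEnvelope_apply]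
    · rw [lower_cosyzCokernel]
      cases i using Fin.cases with
      | zero =>
        have : (0 : Fin (s + 1 + 1)) = Fin.castSucc 0 := rfl
        rw [Pi.add_apply, consZero_zero, this, snocZero_castSucc]
        simp [cosyzEnvelope_apply]
      | succ i =>
        cases i using Fin.lastCases with
        | last =>
          rw [Pi.add_apply, consZero_succ, Fin.succ_last, snocZero_last]
          simp [cosyzEnvelope_apply]
        | cast i =>
          rw [Pi.add_apply, consZero_succ, Fin.succ_castSucc, snocZero_castSucc]
          simp [cosyzEnvelope_apply]
  · intro q hq
    have h0 : ∀ i, co0 (q i) = 0 := fun i => by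
      have := congrFun (upper_cosyzCokernel q) i
      rw [LinearMap.mem_ker.1 hq] at this
      simpa using this.symm
    have h1 : ∀ i, consZero k (s + 1) (fun i => co1 (q i)) i +
        snocZero k (s + 1) (fun i => co2 (q i)) i = 0 := fun i => by
      have := congrFun (lower_cosyzCokernel q) i
      rw [LinearMap.mem_ker.1 hq] at this
      simpa using this.symm
    -- The coordinates along y_0, y_{s+1} and the intermediate y_{i+1} give the three conditions
    -- `h2`, `h3`, `h4`; the two end conditions match the zeros inserted by `consZero` and
    -- `snocZero`.
    have h2 : co2 (q 0) = 0 := by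
      have := h1 (Fin.castSucc 0)
      rwa [snocZero_castSucc, Fin.castSucc_zero, consZero_zero, zero_add] at this
    have h3 : co1 (q (Fin.last s)) = 0 := by
      have := h1 (Fin.last s).succ
      rwa [consZero_succ, Fin.succ_last, snocZero_last, add_zero] at this
    have h4 : ∀ i : Fin s, co1 (q i.castSucc) + co2 (q i.succ) = 0 := fun i => by
      have := h1 i.castSucc.succ
      rwa [consZero_succ, Fin.succ_castSucc, snocZero_castSucc] at this
    refine ⟨inU _ _ _ (fun i => co2 (q i.succ)) + inW _ _ _ (fun i => co3 (q i)), ?_⟩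
    ext i
    · simp [cosyzEnvelope_apply, h0]
    · cases i using Fin.lastCases with
      | last => simp [cosyzEnvelope_apply, h3]
      | cast i =>
        simp only [cosyzEnvelope_apply, map_add, upper_inU, upper_inW, add_zero, co1_of,
          snocZero_castSucc]
        rw [neg_eq_iff_eq_neg, eq_neg_iff_add_eq_zero, add_comm, h4]
    · cases i using Fin.cases with
      | zero => simp [cosyzEnvelope_apply, h2]
      | succ i => simp [cosyzEnvelope_apply]
    · simp [cosyzEnvelope_apply]

/-- The vectors killed by a and d in the sum of copies of P(r) are the combinations of the ad p_i,
which are the images of the y_i; so the image is essential. -/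
theorem isInjectiveEnvelope_cosyzEnvelope (hk : (2 : k) ≠ 0) (r : ZMod 2) (s : ℕ) :
    IsInjectiveEnvelope (cosyzEnvelope k r s) where
  injectiveModule :=
    have := QCarrier.injective (r := r) hk
    inferInstance
  injective := by
    rw [← LinearMap.ker_eq_bot, eq_bot_iff]
    intro x hx
    have h : ∀ i, of r 0 (-snocZero k s (upper x) i) (consZero k s (upper x) i) (lower x i) = 0 :=
      fun i => congrFun (LinearMap.mem_ker.1 hx) i
    rw [Submodule.mem_bot]
    ext i
    · simpa using congrArg co2 (h i.succ)
    · simpa using congrArg co3 (h i)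
  essential N hN := by
    refine eq_bot_of_inf_eq_bot bc_smul_pi (fun q ha hd => ?_) hN
    have ha' : ∀ i, of r 0 (co0 (q i)) 0 (co2 (q i)) = 0 := fun i => by
      rw [← QCarrier.a_smul]; exact congrFun ha i
    have hd' : ∀ i, of r 0 0 (co0 (q i)) (-co1 (q i)) = 0 := fun i => by
      rw [← QCarrier.d_smul]; exact congrFun hd i
    refine ⟨inW _ _ _ fun i => co3 (q i), ?_⟩
    ext i
    · simpa [cosyzEnvelope_apply] using (congrArg co1 (ha' i)).symm
    · simpa [cosyzEnvelope_apply] using (neg_eq_zero.1 (congrArg co3 (hd' i))).symm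
    · simpa [cosyzEnvelope_apply] using (congrArg co3 (ha' i)).symm
    · simp [cosyzEnvelope_apply]

/-! ### The syzygies and the cosyzygies of `V(r)` -/

theorem gen_smul_V {r : ZMod 2} (g : D4Gen) (v : V k r) :
    gen k g • v = onGen 0 (sign k r) (sign k r) 0 g • v := by
  change character k r (gen k g) * (show k from v) = _
  rw [character, lift_gen]
  rfl

/-- The identification of `V(r)` with the ground field. -/
def fieldToV (k : Type u) [Field k] (r : ZMod 2) : k →ₗ[k] V k r where
  toFun z := z
  map_add' _ _ := rfl
  map_smul' _ _ := rfl

/-- `V(r)` as a syzygy. -/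
def syzZeroEquiv (k : Type u) [Field k] (r : ZMod 2) : SyzCarrier k r 0 ≃ₗ[D4 k] V k r :=
  LinearEquiv.ofBijective
    (homOfGen ((fieldToV k r).comp ((LinearMap.proj (R := k) (φ := fun _ => k) 0).comp upper)) (by
      rintro (_ | _ | _ | _) x <;> rw [gen_smul_V] <;>
        simp [onGen, KCarrier.a_smul, KCarrier.b_smul, KCarrier.c_smul, KCarrier.d_smul]))
    ⟨fun x y h => by
      ext i
      · cases i using Fin.cases with
        | zero => exact h
        | succ i => exact i.elim0
      · exact i.elim0,
    fun v => ⟨inU _ _ _ fun _ => v, rfl⟩⟩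

/-- `V(r)` as a cosyzygy. -/
def cosyzZeroEquiv (k : Type u) [Field k] (r : ZMod 2) : CosyzCarrier k (r + 1) 0 ≃ₗ[D4 k] V k r :=
  LinearEquiv.ofBijective
    -- V(r) is carried by y_0, whose sign is opposite to the parameter of the module; hence the
    -- parameter r + 1.
    (homOfGen ((fieldToV k r).comp ((LinearMap.proj (R := k) (φ := fun _ => k) 0).comp lower)) (by
      have h0 : ∀ f : Fin 0 → k, snocZero k 0 f 0 = 0 := snocZero_last
      rintro (_ | _ | _ | _) x <;> rw [gen_smul_V]
      · simp [onGen, KCarrier.a_smul]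
      · simp [onGen, KCarrier.b_smul, sign_add_one, -smul_eq_mul]
      · simp [onGen, KCarrier.c_smul, sign_add_one, -smul_eq_mul]
      · simp [onGen, KCarrier.d_smul, h0]))
    ⟨fun x y h => by
      ext i
      · exact i.elim0
      · cases i using Fin.cases with
        | zero => exact h
        | succ i => exact i.elim0,
    fun v => ⟨inW _ _ _ fun _ => v, rfl⟩⟩

theorem nonempty_P_equiv (hk : (2 : k) ≠ 0) (r : ZMod 2) :
    Nonempty (P k r ≃ₗ[D4 k] QCarrier k r) := by
  obtain ⟨e⟩ := nonempty_projCover_equiv (V k r) (isProjectiveCover_syzCover hk r 0)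
    (syzZeroEquiv k r)
  exact ⟨e.trans (LinearEquiv.funUnique (Fin 1) (D4 k) (QCarrier k r))⟩

/-- Each step of the minimal resolution lengthens the string by one and reverses the sign of the
x_i, because the kernel starts in the vectors a p_i and d p_i. -/
theorem nonempty_syzygy_equiv (hk : (2 : k) ≠ 0) (r : ZMod 2) (s : ℕ) :
    Nonempty ((V k r).syzygy s ≃ₗ[D4 k] SyzCarrier k (r + s) s) := by
  induction s with
  | zero => rw [Nat.cast_zero, add_zero]; exact ⟨(syzZeroEquiv k r).symm⟩
  | succ s ih =>
    obtain ⟨e⟩ := ih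
    rw [FDMod.syzygy, Function.iterate_succ_apply', Nat.cast_add, Nat.cast_one, ← add_assoc]
    exact nonempty_syzygyOne_equiv _ (isProjectiveCover_syzCover hk (r + s) s) e.symm
      (syzKernel k (r + s) s) (syzKernel_injective _ _) (range_syzKernel _ _)

theorem nonempty_cosyzygy_equiv (hk : (2 : k) ≠ 0) (r : ZMod 2) (s : ℕ) :
    Nonempty ((V k r).cosyzygy s ≃ₗ[D4 k] CosyzCarrier k (r + s + 1) s) := by
  induction s with
  | zero => rw [Nat.cast_zero, add_zero]; exact ⟨(cosyzZeroEquiv k r).symm⟩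
  | succ s ih =>
    obtain ⟨e⟩ := ih
    rw [FDMod.cosyzygy, Function.iterate_succ_apply', Nat.cast_add, Nat.cast_one, ← add_assoc,
      add_assoc (r + s) 1 1, show (1 + 1 : ZMod 2) = 0 from rfl, add_zero]
    exact nonempty_cosyzygyOne_equiv _ (isInjectiveEnvelope_cosyzEnvelope hk (r + s) s) e
      (cosyzCokernel k (r + s) s) (cosyzCokernel_surjective _ _) (range_cosyzEnvelope _ _)

/-! ### Weights, and homomorphisms to tensor products -/

section Weight

variable {M N : Type u} [AddCommGroup M] [Module k M] [Module (D4 k) M]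
  [IsScalarTower k (D4 k) M] [AddCommGroup N] [Module k N] [Module (D4 k) N]
  [IsScalarTower k (D4 k) N]

/-- Both `b` and `c` act on `m` as the scalar `(-1)^r`. -/
structure IsWeight (r : ZMod 2) (m : M) : Prop where
  b : gen k .b • m = sign k r • m
  c : gen k .c • m = sign k r • m

namespace IsWeight

variable {M : Type u} [AddCommGroup M] [Module k M] [Module (D4 k) M] {r : ZMod 2} {m n : M}

theorem zero : IsWeight (k := k) r (0 : M) := ⟨by simp, by simp⟩

theorem add (hm : IsWeight (k := k) r m) (hn : IsWeight (k := k) r n) :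
    IsWeight (k := k) r (m + n) :=
  ⟨by rw [smul_add, hm.b, hn.b, smul_add], by rw [smul_add, hm.c, hn.c, smul_add]⟩

theorem smul [IsScalarTower k (D4 k) M] (hm : IsWeight (k := k) r m) (z : k) :
    IsWeight (k := k) r (z • m) :=
  ⟨by rw [gen_smul_smul, hm.b, smul_comm], by rw [gen_smul_smul, hm.c, smul_comm]⟩

theorem sub (hm : IsWeight (k := k) r m) (hn : IsWeight (k := k) r n) :
    IsWeight (k := k) r (m - n) :=
  ⟨by rw [smul_sub, hm.b, hn.b, smul_sub], by rw [smul_sub, hm.c, hn.c, smul_sub]⟩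

theorem sum {ι : Type} (S : Finset ι) {f : ι → M} (hf : ∀ i ∈ S, IsWeight (k := k) r (f i)) :
    IsWeight (k := k) r (∑ i ∈ S, f i) :=
  ⟨by rw [Finset.smul_sum, Finset.smul_sum]; exact Finset.sum_congr rfl fun i hi => (hf i hi).b,
    by rw [Finset.smul_sum, Finset.smul_sum]; exact Finset.sum_congr rfl fun i hi => (hf i hi).c⟩

end IsWeight

/-- The pure tensors in the diagonal tensor product. -/
def tmk (k : Type u) [Field k] {M N : Type u} [AddCommGroup M] [Module k M] [Module (D4 k) M]
    [IsScalarTower k (D4 k) M] [AddCommGroup N] [Module k N] [Module (D4 k) N]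
    [IsScalarTower k (D4 k) N] : M →ₗ[k] N →ₗ[k] DiagTensor k (D4 k) M N :=
  TensorProduct.mk k M N

theorem a_smul_tmk (m : M) (n : N) :
    gen k .a • tmk k m n = tmk k (gen k .a • m) (gen k .b • n) + tmk k m (gen k .a • n) := by
  have h : comul k (gen k .a) = gen k .a ⊗ₜ gen k .b + 1 ⊗ₜ gen k .a := lift_gen _ _
  change DiagTensor.rho k (D4 k) M N (gen k .a) (m ⊗ₜ n) = _
  change Module.endTensorEndAlgHom (Algebra.TensorProduct.map (Algebra.lsmul k k M)
    (Algebra.lsmul k k N) (comul k (gen k .a))) (m ⊗ₜ n) = _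
  rw [h]
  simp
  rfl

theorem b_smul_tmk (m : M) (n : N) :
    gen k .b • tmk k m n = tmk k (gen k .b • m) (gen k .b • n) := by
  have h : comul k (gen k .b) = gen k .b ⊗ₜ gen k .b := lift_gen _ _
  change Module.endTensorEndAlgHom (Algebra.TensorProduct.map (Algebra.lsmul k k M)
    (Algebra.lsmul k k N) (comul k (gen k .b))) (m ⊗ₜ n) = _
  rw [h]
  simp
  rfl

theorem c_smul_tmk (m : M) (n : N) :
    gen k .c • tmk k m n = tmk k (gen k .c • m) (gen k .c • n) := by
  have h : comul k (gen k .c) = gen k .c ⊗ₜ gen k .c := lift_gen _ _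
  change Module.endTensorEndAlgHom (Algebra.TensorProduct.map (Algebra.lsmul k k M)
    (Algebra.lsmul k k N) (comul k (gen k .c))) (m ⊗ₜ n) = _
  rw [h]
  simp
  rfl

theorem d_smul_tmk (m : M) (n : N) :
    gen k .d • tmk k m n = tmk k (gen k .d • m) (gen k .c • n) + tmk k m (gen k .d • n) := by
  have h : comul k (gen k .d) = gen k .d ⊗ₜ gen k .c + 1 ⊗ₜ gen k .d := lift_gen _ _
  change Module.endTensorEndAlgHom (Algebra.TensorProduct.map (Algebra.lsmul k k M)
    (Algebra.lsmul k k N) (comul k (gen k .d))) (m ⊗ₜ n) = _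
  rw [h]
  simp
  rfl

theorem IsWeight.tmk {r r' : ZMod 2} {m : M} {n : N} (hm : IsWeight (k := k) r m)
    (hn : IsWeight (k := k) r' n) : IsWeight (k := k) (r + r') (tmk k m n) :=
  ⟨by rw [b_smul_tmk, hm.b, hn.b, map_smul, map_smul, LinearMap.smul_apply, smul_smul, mul_comm,
      sign_add],
    by rw [c_smul_tmk, hm.c, hn.c, map_smul, map_smul, LinearMap.smul_apply, smul_smul, mul_comm,
      sign_add]⟩

/-- The tensor product of two functionals. -/
def functional (f : M →ₗ[k] k) (g : N →ₗ[k] k) : DiagTensor k (D4 k) M N →ₗ[k] k :=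
  TensorProduct.lift ((LinearMap.mul k k).compl₁₂ f g)

@[simp] theorem functional_tmk (f : M →ₗ[k] k) (g : N →ₗ[k] k) (m : M) (n : N) :
    functional f g (tmk k m n) = f m * g n := rfl

theorem finrank_diagTensor [Module.Finite k M] [Module.Finite k N] :
    Module.finrank k (DiagTensor k (D4 k) M N) = Module.finrank k M * Module.finrank k N :=
  Module.finrank_tensorProduct

@[elab_as_elim]
theorem diagTensor_induction {p : DiagTensor k (D4 k) M N → Prop} (z : DiagTensor k (D4 k) M N)
    (zero : p 0) (tmk : ∀ m n, p (tmk k m n)) (add : ∀ x y, p x → p y → p (x + y)) : p z :=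
  TensorProduct.induction_on z zero tmk add

/-- The diagonal tensor product of two isomorphisms. -/
def tensorCongr {M' N' : Type u} [AddCommGroup M'] [Module k M'] [Module (D4 k) M']
    [IsScalarTower k (D4 k) M'] [AddCommGroup N'] [Module k N'] [Module (D4 k) N']
    [IsScalarTower k (D4 k) N'] (e : M ≃ₗ[D4 k] M') (e' : N ≃ₗ[D4 k] N') :
    DiagTensor k (D4 k) M N ≃ₗ[D4 k] DiagTensor k (D4 k) M' N' :=
  let f : DiagTensor k (D4 k) M N ≃ₗ[k] DiagTensor k (D4 k) M' N' :=
    TensorProduct.congr (e.restrictScalars k) (e'.restrictScalars k)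
  have hf : ∀ m n, f (tmk k m n) = tmk k (e m) (e' n) := fun _ _ => rfl
  LinearEquiv.ofBijective (homOfGen f.toLinearMap (by
    intro g z
    induction z using diagTensor_induction with
    | zero => simp
    | tmk m n =>
      simp only [LinearEquiv.coe_coe]
      cases g
      · rw [a_smul_tmk, map_add, hf, hf, hf, a_smul_tmk, e.map_smul, e'.map_smul, e'.map_smul]
      · rw [b_smul_tmk, hf, hf, b_smul_tmk, e.map_smul, e'.map_smul]
      · rw [c_smul_tmk, hf, hf, c_smul_tmk, e.map_smul, e'.map_smul]
      · rw [d_smul_tmk, map_add, hf, hf, hf, d_smul_tmk, e.map_smul, e'.map_smul, e'.map_smul]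
    | add x y hx hy => rw [smul_add, map_add, hx, hy, map_add, smul_add])) f.bijective

end Weight

/-! ### Maps out of modules of Loewy length two, and a splitting criterion -/

section KHom

variable {M : Type u} [AddCommGroup M] [Module k M] [Module (D4 k) M] [IsScalarTower k (D4 k) M]
  {r : ZMod 2} {U W : Type u} [AddCommGroup U] [Module k U] [AddCommGroup W] [Module k W]
  {A D : U →ₗ[k] W}

/-- The homomorphism from a module of Loewy length two with given restrictions. -/
def KCarrier.toModule (F : U →ₗ[k] M) (G : W →ₗ[k] M) (hF : ∀ v, IsWeight (k := k) r (F v))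
    (hG : ∀ w, IsWeight (k := k) (r + 1) (G w)) (haF : ∀ v, gen k .a • F v = G (A v))
    (hdF : ∀ v, gen k .d • F v = G (D v)) (haG : ∀ w, gen k .a • G w = 0)
    (hdG : ∀ w, gen k .d • G w = 0) : KCarrier r A D →ₗ[D4 k] M :=
  homOfGen (F.comp upper + G.comp lower) (by
    rintro (_ | _ | _ | _) x
    · simp [KCarrier.a_smul, haF, haG]
    · simp [KCarrier.b_smul, (hF _).b, (hG _).b, sign_add_one, sub_eq_add_neg]
    · simp [KCarrier.c_smul, (hF _).c, (hG _).c, sign_add_one, sub_eq_add_neg]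
    · simp [KCarrier.d_smul, hdF, hdG])

theorem KCarrier.toModule_inW (F : U →ₗ[k] M) (G : W →ₗ[k] M)
    (hF : ∀ v, IsWeight (k := k) r (F v))
    (hG : ∀ w, IsWeight (k := k) (r + 1) (G w)) (haF : ∀ v, gen k .a • F v = G (A v))
    (hdF : ∀ v, gen k .d • F v = G (D v)) (haG : ∀ w, gen k .a • G w = 0)
    (hdG : ∀ w, gen k .d • G w = 0) (w : W) :
    KCarrier.toModule F G hF hG haF hdF haG hdG (inW r A D w) = G w := by
  simp [KCarrier.toModule]

theorem finrank_KCarrier [Module.Finite k U] [Module.Finite k W] :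
    Module.finrank k (KCarrier r A D) = Module.finrank k U + Module.finrank k W :=
  Module.finrank_prod

theorem finrank_QCarrier (r : ZMod 2) : Module.finrank k (QCarrier k r) = 4 := by
  change Module.finrank k (k × k × k × k) = 4
  simp

/-- A criterion for a module to split into a module of Loewy length two and copies of `P(r)`. -/
theorem nonempty_equiv_prod [Module.Finite k M] [Module.Finite k U] [Module.Finite k W]
    (hK : ∀ v : U, A v = 0 → D v = 0 → v = 0) (f : KCarrier r A D →ₗ[D4 k] M)
    {n : Type} [Fintype n] {ρ : ZMod 2} {w : n → M} (hw : ∀ i, IsWeight (k := k) ρ (w i))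
    (hind : ∀ (v : W) (z : n → k),
      f (inW r A D v) + ∑ i, z i • gen k .a • gen k .d • w i = 0 → v = 0 ∧ ∀ i, z i = 0)
    (hrank : Module.finrank k M =
      Module.finrank k U + Module.finrank k W + Fintype.card n * 4) :
    Nonempty (M ≃ₗ[D4 k] KCarrier r A D × (n → QCarrier k ρ)) := by
  let g : (n → QCarrier k ρ) →ₗ[D4 k] M :=
    ∑ i, (QCarrier.toModule (w i) (hw i).b (hw i).c).comp (LinearMap.proj i)
  have hg : ∀ q, g q = ∑ i, QCarrier.toModule (w i) (hw i).b (hw i).c (q i) := fun q => by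
    simp [g]
  -- Injectivity is tested on vectors killed by a and d. By `hK` these have zero upper part, and in
  -- each P(ρ) only the coordinate along adp survives, so the test is exactly `hind`.
  have hinj : Function.Injective (f.coprod g) := by
    refine injective_of_socle (fun m => ?_) _ ?_
    · exact Prod.ext (KCarrier.bc_smul _) (bc_smul_pi _)
    · rintro ⟨x, q⟩ ha hd h
      have hax : inW r A D (A (upper x)) = 0 := by
        rw [← KCarrier.a_smul]; exact congrArg Prod.fst ha
      have hdx : inW r A D (D (upper x)) = 0 := by
        rw [← KCarrier.d_smul]; exact congrArg Prod.fst hd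
      have hx : upper x = 0 :=
        hK _ (by simpa using congrArg lower hax) (by simpa using congrArg lower hdx)
      have haq : ∀ i, of ρ 0 (co0 (q i)) 0 (co2 (q i)) = 0 := fun i => by
        rw [← QCarrier.a_smul]; exact congrFun (congrArg Prod.snd ha) i
      have hdq : ∀ i, of ρ 0 0 (co0 (q i)) (-co1 (q i)) = 0 := fun i => by
        rw [← QCarrier.d_smul]; exact congrFun (congrArg Prod.snd hd) i
      have h0 : ∀ i, co0 (q i) = 0 := fun i => by simpa using congrArg co1 (haq i)
      have h2 : ∀ i, co2 (q i) = 0 := fun i => by simpa using congrArg co3 (haq i)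
      have h1 : ∀ i, co1 (q i) = 0 := fun i => by simpa using congrArg co3 (hdq i)
      have hx' : x = inW r A D (lower x) := by ext <;> simp [hx]
      rw [LinearMap.coprod_apply, hg] at h
      simp only [QCarrier.toModule_apply, h0, h1, h2, zero_smul, zero_add] at h
      rw [hx'] at h
      obtain ⟨h3, h4⟩ := hind _ _ h
      refine Prod.ext ?_ (funext fun i => ?_)
      · rw [hx']; simp [h3]
      · ext <;> simp [h0, h1, h2, h4]
  have hfin : Module.finrank k (KCarrier r A D × (n → QCarrier k ρ)) = Module.finrank k M := by
    rw [hrank, Module.finrank_prod, finrank_KCarrier, Module.finrank_pi_fintype]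
    simp [finrank_QCarrier]
  have hsurj : Function.Surjective ((f.coprod g).restrictScalars k) :=
    (LinearMap.injective_iff_surjective_of_finrank_eq_finrank hfin).1 hinj
  exact ⟨(LinearEquiv.ofBijective (f.coprod g) ⟨hinj, hsurj⟩).symm⟩

end KHom

/-! ### Tensor products of syzygies -/

open Finset in
-- The pair (i, j) occurs once on the antidiagonal of i + j and on no other. This evaluates
-- coordinates of convolutions of basis vectors.
theorem sum_antidiagonal_ite (n i j : ℕ) :
    (∑ p ∈ antidiagonal n, if j = p.2 then if i = p.1 then (1 : k) else 0 else 0) =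
      if i + j = n then 1 else 0 := by
  split_ifs with h
  · rw [sum_eq_single (i, j) (fun p _ hp => ?_) (by simp [h])]
    · simp
    · split_ifs with h1 h2
      · exact absurd (Prod.ext h2.symm h1.symm) hp
      · rfl
      · rfl
  · refine sum_eq_zero fun p hp => ?_
    rw [HasAntidiagonal.mem_antidiagonal] at hp
    split_ifs with h1 h2
    · omega
    · rfl
    · rfl

section Strings

variable {M N : Type u} [AddCommGroup M] [Module k M] [Module (D4 k) M]
  [IsScalarTower k (D4 k) M] [AddCommGroup N] [Module k N] [Module (D4 k) N]
  [IsScalarTower k (D4 k) N]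

/-- The terms with two factors from the same side vanish. The relative minus sign arises because b
acts on y'_0 with the sign opposite to that of c on x'_0. -/
theorem ad_smul_tmk {r' : ZMod 2} {x₀ y₀ y₁ : M} {x₀' y₀' y₁' : N}
    (ha : gen k .a • x₀ = y₁) (hd : gen k .d • x₀ = y₀) (hay : gen k .a • y₀ = 0)
    (ha' : gen k .a • x₀' = y₁') (hd' : gen k .d • x₀' = y₀') (hay' : gen k .a • y₀' = 0)
    (hx' : IsWeight (k := k) r' x₀') (hy' : IsWeight (k := k) (r' + 1) y₀') :
    gen k .a • gen k .d • tmk k x₀ x₀' = sign k r' • (tmk k y₀ y₁' - tmk k y₁ y₀') := by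
  rw [d_smul_tmk, hd, hd', hx'.c, map_smul, smul_add, gen_smul_smul, a_smul_tmk, a_smul_tmk, ha,
    ha', hay, hay', hy'.b, sign_add_one]
  simp [sub_eq_add_neg]

/-- Vectors that span a module like the syzygy `Ω^s V(r + s)`: `a` and `d` take `x_i` to `y_{i+1}`
and to `y_i`. -/
structure SyzString (k : Type u) [Field k] {M : Type u} [AddCommGroup M] [Module k M]
    [Module (D4 k) M] (r : ZMod 2) (s : ℕ) (x y : ℕ → M) : Prop where
  x_zero : ∀ i, s < i → x i = 0
  y_zero : y 0 = 0
  y_zero' : ∀ i, s < i → y i = 0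
  weight_x : ∀ i, IsWeight (k := k) r (x i)
  weight_y : ∀ i, IsWeight (k := k) (r + 1) (y i)
  a_x : ∀ i, gen k .a • x i = y (i + 1)
  d_x : ∀ i, gen k .d • x i = y i
  a_y : ∀ i, gen k .a • y i = 0
  d_y : ∀ i, gen k .d • y i = 0

/-- The homomorphism from the standard module to a module with a string of vectors. -/
def SyzString.hom {r : ZMod 2} {s : ℕ} {x y : ℕ → M} (h : SyzString k r s x y) :
    SyzCarrier k r s →ₗ[D4 k] M :=
  KCarrier.toModule (Fintype.linearCombination k fun i : Fin (s + 1) => x i)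
    (Fintype.linearCombination k fun i : Fin s => y (i + 1))
    (fun v => by
      rw [Fintype.linearCombination_apply]
      exact IsWeight.sum _ fun i _ => (h.weight_x i).smul _)
    (fun v => by
      rw [Fintype.linearCombination_apply]
      exact IsWeight.sum _ fun i _ => (h.weight_y _).smul _)
    (fun v => by
      simp only [Fintype.linearCombination_apply, Finset.smul_sum, gen_smul_smul, h.a_x]
      rw [Fin.sum_univ_castSucc]
      simp [h.y_zero', LinearMap.funLeft_apply])
    (fun v => by
      simp only [Fintype.linearCombination_apply, Finset.smul_sum, gen_smul_smul, h.d_x]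
      rw [Fin.sum_univ_succ]
      simp [h.y_zero, LinearMap.funLeft_apply])
    (fun v => by
      simp [Fintype.linearCombination_apply, Finset.smul_sum, gen_smul_smul, h.a_y])
    (fun v => by
      simp [Fintype.linearCombination_apply, Finset.smul_sum, gen_smul_smul, h.d_y])

theorem SyzString.hom_inW {r : ZMod 2} {s : ℕ} {x y : ℕ → M} (h : SyzString k r s x y)
    (v : Fin s → k) : h.hom (inW _ _ _ v) = ∑ i, v i • y (i + 1) := by
  rw [SyzString.hom, KCarrier.toModule_inW, Fintype.linearCombination_apply]

open Finset in
/-- The convolution of two strings. -/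
theorem SyzString.tensor {r r' : ZMod 2} {s t : ℕ} {x y : ℕ → M} {x' y' : ℕ → N}
    (h : SyzString k r s x y) (h' : SyzString k r' t x' y') :
    SyzString k (r + r') (s + t) (fun n => ∑ p ∈ antidiagonal n, tmk k (x p.1) (x' p.2))
      (fun n => ∑ p ∈ antidiagonal n,
        (sign k r' • tmk k (y p.1) (x' p.2) + tmk k (x p.1) (y' p.2))) where
  x_zero n hn := sum_eq_zero fun p hp => by
    rw [HasAntidiagonal.mem_antidiagonal] at hp
    rcases lt_or_ge s p.1 with h1 | h1
    · simp [h.x_zero _ h1]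
    · simp [h'.x_zero p.2 (by omega)]
  y_zero := by simp [h.y_zero, h'.y_zero]
  y_zero' n hn := sum_eq_zero fun p hp => by
    rw [HasAntidiagonal.mem_antidiagonal] at hp
    rcases lt_or_ge s p.1 with h1 | h1
    · simp [h.x_zero _ h1, h.y_zero' _ h1]
    · simp [h'.x_zero p.2 (by omega), h'.y_zero' p.2 (by omega)]
  weight_x n := IsWeight.sum _ fun p _ => (h.weight_x _).tmk (h'.weight_x _)
  weight_y n := IsWeight.sum _ fun p _ => by
    refine IsWeight.add (IsWeight.smul ?_ _) ?_
    · rw [add_right_comm]; exact (h.weight_y _).tmk (h'.weight_x _)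
    · rw [add_assoc]; exact (h.weight_x _).tmk (h'.weight_y _)
  a_x n := by
    simp only [smul_sum, a_smul_tmk, h.a_x, h'.a_x, (h'.weight_x _).b, map_smul, sum_add_distrib]
    -- The antidiagonal of n + 1 is that of n with one index shifted, plus an end term containing
    -- y_0 or y'_0, which is zero.
    rw [Nat.sum_antidiagonal_succ, Nat.sum_antidiagonal_succ']
    simp [h.y_zero, h'.y_zero]
  d_x n := by
    simp only [smul_sum, d_smul_tmk, h.d_x, h'.d_x, (h'.weight_x _).c, map_smul]
  a_y n := by
    simp only [smul_sum, smul_add, gen_smul_smul, a_smul_tmk, h.a_x, h'.a_x, h.a_y, h'.a_y,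
      (h'.weight_y _).b, sign_add_one, sum_add_distrib, map_zero, LinearMap.zero_apply, zero_add,
      add_zero, neg_smul, map_neg, map_smul, sum_neg_distrib]
    -- The two sums left over, of y_i ⊗ y'_{j+1} and of y_{i+1} ⊗ y'_j, are both the sum of y_i ⊗
    -- y'_j over i + j = n + 1, and they have opposite signs.
    have h1 := (Nat.sum_antidiagonal_succ (n := n)
      (f := fun p => sign k r' • tmk k (y p.1) (y' p.2))).symm.trans
      (Nat.sum_antidiagonal_succ' (n := n) (f := fun p => sign k r' • tmk k (y p.1) (y' p.2)))
    simp only [h.y_zero, h'.y_zero, map_zero, LinearMap.zero_apply, smul_zero, zero_add] at h1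
    rw [h1, add_neg_cancel]
  d_y n := by
    simp only [smul_sum, smul_add, gen_smul_smul, d_smul_tmk, h.d_x, h'.d_x, h.d_y, h'.d_y,
      (h'.weight_y _).c, sign_add_one, sum_add_distrib, map_zero, LinearMap.zero_apply, zero_add,
      add_zero, neg_smul, map_neg, map_smul, sum_neg_distrib, add_neg_cancel]

/-- Telescoping along an antidiagonal: up to sign, ad(x_i ⊗ x'_j) is the difference of y_i ⊗
y'_{j+1} and y_{i+1} ⊗ y'_j, and the chain begins with y_0 = 0. -/
theorem SyzString.exists_ad {r r' : ZMod 2} {s t : ℕ} {x y : ℕ → M} {x' y' : ℕ → N}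
    (h : SyzString k r s x y) (h' : SyzString k r' t x' y') (i j : ℕ) :
    ∃ w, IsWeight (k := k) (r + r') w ∧ gen k .a • gen k .d • w = tmk k (y i) (y' j) := by
  induction i generalizing j with
  | zero => exact ⟨0, IsWeight.zero, by simp [h.y_zero]⟩
  | succ i ih =>
    obtain ⟨w, hw, hw'⟩ := ih (j + 1)
    refine ⟨w - sign k r' • tmk k (x i) (x' j),
      hw.sub (((h.weight_x i).tmk (h'.weight_x j)).smul _), ?_⟩
    rw [smul_sub, smul_sub, hw', gen_smul_smul, gen_smul_smul, ad_smul_tmk (h.a_x i) (h.d_x i)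
      (h.a_y i) (h'.a_x j) (h'.d_x j) (h'.a_y j) (h'.weight_x j) (h'.weight_y j), smul_smul,
      sign_mul_self, one_smul, sub_sub_cancel]

end Strings

/-- The basis vectors `x_i`. -/
def syzX (k : Type u) [Field k] (r : ZMod 2) (s i : ℕ) : SyzCarrier k r s :=
  inU _ _ _ fun j => if j.val = i then 1 else 0

/-- The basis vectors `y_i`. -/
def syzY (k : Type u) [Field k] (r : ZMod 2) (s i : ℕ) : SyzCarrier k r s :=
  inW _ _ _ fun j => if j.val + 1 = i then 1 else 0

theorem isWeight_inU {r : ZMod 2} {U W : Type u} [AddCommGroup U] [Module k U] [AddCommGroup W]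
    [Module k W] {A D : U →ₗ[k] W} (v : U) : IsWeight (k := k) r (inU r A D v) :=
  ⟨by ext <;> simp [KCarrier.b_smul], by ext <;> simp [KCarrier.c_smul]⟩

theorem isWeight_inW {r : ZMod 2} {U W : Type u} [AddCommGroup U] [Module k U] [AddCommGroup W]
    [Module k W] {A D : U →ₗ[k] W} (w : W) : IsWeight (k := k) (r + 1) (inW r A D w) :=
  ⟨by ext <;> simp [KCarrier.b_smul, sign_add_one], by ext <;> simp [KCarrier.c_smul, sign_add_one]⟩

theorem syzString (r : ZMod 2) (s : ℕ) : SyzString k r s (syzX k r s) (syzY k r s) where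
  x_zero i hi := by ext j <;> simp [syzX]; omega
  y_zero := by ext j <;> simp [syzY]
  y_zero' i hi := by ext j <;> simp [syzY]; omega
  weight_x i := isWeight_inU _
  weight_y i := isWeight_inW _
  a_x i := by ext j <;> simp [syzX, syzY, KCarrier.a_smul, LinearMap.funLeft_apply]
  d_x i := by ext j <;> simp [syzX, syzY, KCarrier.d_smul, LinearMap.funLeft_apply]
  a_y i := by ext j <;> simp [syzY, KCarrier.a_smul]
  d_y i := by ext j <;> simp [syzY, KCarrier.d_smul]

open Finset in
-- The projective summands have socles spanned by the y_i ⊗ y'_j, whereas the lower vectors of the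
-- convolution have only components of type y ⊗ x' and x ⊗ y'. The two families are therefore
-- separated by type.
theorem nonempty_syz_tensor (r r' : ZMod 2) {s t : ℕ} (hs : 1 ≤ s) (ht : 1 ≤ t) :
    Nonempty (DiagTensor k (D4 k) (SyzCarrier k r s) (SyzCarrier k r' t) ≃ₗ[D4 k]
      SyzCarrier k (r + r') (s + t) × (Fin s × Fin t → QCarrier k (r + r'))) := by
  choose w hw hw' using fun p : Fin s × Fin t =>
    (syzString (k := k) r s).exists_ad (syzString r' t) (p.1 + 1) (p.2 + 1)
  refine nonempty_equiv_prod (fun v hA hD => ?_) ((syzString r s).tensor (syzString r' t)).hom hw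
    (fun v z hz => ?_) ?_
  · ext i
    cases i using Fin.lastCases with
    | cast i => exact congrFun hA i
    | last =>
      -- The last coordinate is invisible to a, and d detects it because s + t > 0.
      obtain ⟨n, hn⟩ : ∃ n, s + t = n + 1 := ⟨s + t - 1, by omega⟩
      have : Fin.last (s + t) = Fin.succ ⟨n, by omega⟩ := by ext; simp [hn]
      rw [this]
      exact congrFun hD _
  · rw [SyzString.hom_inW] at hz
    simp only [hw'] at hz
    -- Coordinates of type y ⊗ y' kill the convolution and isolate each z p.
    have hz0 : ∀ p, z p = 0 := by
      rintro ⟨i, j⟩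
      have := congrArg (functional ((LinearMap.proj (R := k) (φ := fun _ => k) i).comp lower)
        ((LinearMap.proj (R := k) (φ := fun _ => k) j).comp lower)) hz
      simp only [map_add, map_sum, map_smul, functional_tmk] at this
      simp [syzX, syzY, Fin.val_inj, Fintype.sum_prod_type] at this
      exact this
    refine ⟨funext fun n => ?_, hz0⟩
    simp only [hz0, zero_smul, sum_const_zero, add_zero] at hz
    -- The coefficient of the (n+1)-st lower vector is read off at any x_i ⊗ y'_{j+1} with i + j =
    -- n; such a pair exists because t ≥ 1.
    obtain ⟨i, j, hij⟩ : ∃ (i : Fin (s + 1)) (j : Fin t), i.val + j.val = n.val := by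
      rcases le_total n.val s with h | h
      · exact ⟨⟨n, by omega⟩, ⟨0, ht⟩, rfl⟩
      · exact ⟨⟨s, by omega⟩, ⟨n - s, by omega⟩, by simp; omega⟩
    have := congrArg (functional ((LinearMap.proj (R := k) (φ := fun _ => k) i).comp upper)
        ((LinearMap.proj (R := k) (φ := fun _ => k) j).comp lower)) hz
    simp only [map_add, map_sum, map_smul, functional_tmk] at this
    simp [syzX, syzY, sum_antidiagonal_ite] at this
    rw [sum_eq_single n (fun m _ hm => by
      rw [if_neg (fun h => hm (Fin.ext (by omega)))]) (by simp), if_pos (by omega)] at this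
    exact this
  · rw [finrank_diagTensor, finrank_KCarrier, finrank_KCarrier]
    simp
    ring

/-! ### Tensor products of cosyzygies -/

section Strings

variable {M N : Type u} [AddCommGroup M] [Module k M] [Module (D4 k) M]
  [IsScalarTower k (D4 k) M] [AddCommGroup N] [Module k N] [Module (D4 k) N]
  [IsScalarTower k (D4 k) N]

/-- Vectors that span a module like the cosyzygies of `V(r)`: for `i < s`, the generators `a` and
`d` take `x_i` to `y_{i+1}` and to `y_i`. -/
structure CosyzString (k : Type u) [Field k] {M : Type u} [AddCommGroup M] [Module k M]
    [Module (D4 k) M] (r : ZMod 2) (s : ℕ) (x y : ℕ → M) : Prop where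
  weight_x : ∀ i, IsWeight (k := k) r (x i)
  weight_y : ∀ i, IsWeight (k := k) (r + 1) (y i)
  a_x : ∀ i < s, gen k .a • x i = y (i + 1)
  d_x : ∀ i < s, gen k .d • x i = y i
  a_y : ∀ i, gen k .a • y i = 0
  d_y : ∀ i, gen k .d • y i = 0

/-- The homomorphism from the standard module to a module with a string of vectors. -/
def CosyzString.hom {r : ZMod 2} {s : ℕ} {x y : ℕ → M} (h : CosyzString k r s x y) :
    CosyzCarrier k r s →ₗ[D4 k] M :=
  KCarrier.toModule (Fintype.linearCombination k fun i : Fin s => x i)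
    (Fintype.linearCombination k fun i : Fin (s + 1) => y i)
    (fun v => by
      rw [Fintype.linearCombination_apply]
      exact IsWeight.sum _ fun i _ => (h.weight_x i).smul _)
    (fun v => by
      rw [Fintype.linearCombination_apply]
      exact IsWeight.sum _ fun i _ => (h.weight_y _).smul _)
    (fun v => by
      simp only [Fintype.linearCombination_apply, Finset.smul_sum, gen_smul_smul]
      rw [Fin.sum_univ_succ]
      simp [h.a_x])
    (fun v => by
      simp only [Fintype.linearCombination_apply, Finset.smul_sum, gen_smul_smul]
      rw [Fin.sum_univ_castSucc]
      simp [h.d_x])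
    (fun v => by
      simp [Fintype.linearCombination_apply, Finset.smul_sum, gen_smul_smul, h.a_y])
    (fun v => by
      simp [Fintype.linearCombination_apply, Finset.smul_sum, gen_smul_smul, h.d_y])

theorem CosyzString.hom_inW {r : ZMod 2} {s : ℕ} {x y : ℕ → M} (h : CosyzString k r s x y)
    (v : Fin (s + 1) → k) : h.hom (inW _ _ _ v) = ∑ i, v i • y i := by
  rw [CosyzString.hom, KCarrier.toModule_inW, Fintype.linearCombination_apply]

/-- The concatenation of two strings. -/
theorem CosyzString.tensor {r r' : ZMod 2} {s t : ℕ} {x y : ℕ → M} {x' y' : ℕ → N}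
    (h : CosyzString k r s x y) (h' : CosyzString k r' t x' y') :
    CosyzString k (r + r' + 1) (s + t)
      -- Truncated subtraction makes (min n s, n - s) run from (0, 0) to (s, 0) and on to (s, t).
      -- The factor (-1)^(r'+1) on the first leg cancels the sign of b and c on y'_0; the second leg
      -- needs none, as a and d kill y_s.
      (fun n => if n < s then sign k (r' + 1) • tmk k (x n) (y' 0) else tmk k (y s) (x' (n - s)))
      (fun n => tmk k (y (min n s)) (y' (n - s))) where
  weight_x n := by
    split_ifs
    · rw [add_assoc]; exact ((h.weight_x _).tmk (h'.weight_y _)).smul _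
    · rw [add_right_comm]; exact (h.weight_y _).tmk (h'.weight_x _)
  weight_y n := by
    rw [add_assoc, add_add_add_comm]
    exact (h.weight_y (min n s)).tmk (h'.weight_y (n - s))
  a_x n hn := by
    split_ifs with hns
    · rw [gen_smul_smul, a_smul_tmk, h.a_x n hns, h'.a_y, (h'.weight_y 0).b, map_smul, map_zero,
        add_zero, smul_smul, sign_mul_self, one_smul, min_eq_left hns, Nat.sub_eq_zero_of_le hns]
    · rw [a_smul_tmk, h.a_y, h'.a_x (n - s) (by omega), map_zero, LinearMap.zero_apply, zero_add,
        min_eq_right (by omega), Nat.sub_add_comm (by omega)]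
  d_x n hn := by
    split_ifs with hns
    · rw [gen_smul_smul, d_smul_tmk, h.d_x n hns, h'.d_y, (h'.weight_y 0).c, map_smul, map_zero,
        add_zero, smul_smul, sign_mul_self, one_smul, min_eq_left hns.le,
        Nat.sub_eq_zero_of_le hns.le]
    · rw [d_smul_tmk, h.d_y, h'.d_x (n - s) (by omega), map_zero, LinearMap.zero_apply, zero_add,
        min_eq_right (by omega)]
  a_y n := by rw [a_smul_tmk, h.a_y, h'.a_y]; simp
  d_y n := by rw [d_smul_tmk, h.d_y, h'.d_y]; simp

end Strings

/-- The basis vectors `x_i`. -/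
def cosyzX (k : Type u) [Field k] (r : ZMod 2) (s i : ℕ) : CosyzCarrier k r s :=
  inU _ _ _ fun j => if j.val = i then 1 else 0

/-- The basis vectors `y_i`. -/
def cosyzY (k : Type u) [Field k] (r : ZMod 2) (s i : ℕ) : CosyzCarrier k r s :=
  inW _ _ _ fun j => if j.val = i then 1 else 0

theorem cosyzString (r : ZMod 2) (s : ℕ) : CosyzString k r s (cosyzX k r s) (cosyzY k r s) where
  weight_x i := isWeight_inU _
  weight_y i := isWeight_inW _
  a_x i hi := by
    ext j
    · simp [cosyzY, KCarrier.a_smul]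
    · cases j using Fin.cases <;> simp [cosyzX, cosyzY, KCarrier.a_smul]
  d_x i hi := by
    ext j
    · simp [cosyzY, KCarrier.d_smul]
    · cases j using Fin.lastCases with
      | last => simp [cosyzX, cosyzY, KCarrier.d_smul, hi.ne']
      | cast j => simp [cosyzX, cosyzY, KCarrier.d_smul]
  a_y i := by ext j <;> simp [cosyzY, KCarrier.a_smul]
  d_y i := by ext j <;> simp [cosyzY, KCarrier.d_smul]

/-- The coordinate at `y_i`. -/
def cosyzCoord (k : Type u) [Field k] (r : ZMod 2) (s i : ℕ) : CosyzCarrier k r s →ₗ[k] k :=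
  if h : i < s + 1 then (LinearMap.proj (R := k) (φ := fun _ => k) ⟨i, h⟩).comp lower else 0

theorem cosyzCoord_cosyzY (r : ZMod 2) {s : ℕ} (i : ℕ) {j : ℕ} (hj : j ≤ s) :
    cosyzCoord k r s i (cosyzY k r s j) = if j = i then 1 else 0 := by
  unfold cosyzCoord
  split_ifs with h h' h'
  · simp [cosyzY, h']
  · simp [cosyzY, Ne.symm h']
  · omega
  · rfl

open Finset in
-- Modulo the vectors ad(x_i ⊗ x'_j), the class of y_i ⊗ y'_j depends, for a given i + j, on nothing
-- else. The path contains one such vector for each value of i + j, so it complements the socles of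
-- the projective summands.
theorem nonempty_cosyz_tensor (r r' : ZMod 2) (s t : ℕ) :
    Nonempty (DiagTensor k (D4 k) (CosyzCarrier k r s) (CosyzCarrier k r' t) ≃ₗ[D4 k]
      CosyzCarrier k (r + r' + 1) (s + t) × (Fin s × Fin t → QCarrier k (r + r'))) := by
  refine nonempty_equiv_prod (fun v hA _ => ?_) ((cosyzString r s).tensor (cosyzString r' t)).hom
    (w := fun p : Fin s × Fin t => tmk k (cosyzX k r s p.1) (cosyzX k r' t p.2))
    (fun p => ((cosyzString r s).weight_x _).tmk ((cosyzString r' t).weight_x _))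
    (fun v z hz => ?_) ?_
  · ext i
    simpa using congrFun hA i.succ
  · rw [CosyzString.hom_inW] at hz
    have had : ∀ p : Fin s × Fin t, gen k .a • gen k .d •
        tmk k (cosyzX k r s p.1) (cosyzX k r' t p.2) = sign k r' •
          (tmk k (cosyzY k r s p.1) (cosyzY k r' t (p.2 + 1)) -
            tmk k (cosyzY k r s (p.1 + 1)) (cosyzY k r' t p.2)) := fun p => by
      have h := cosyzString (k := k) r s
      have h' := cosyzString (k := k) r' t
      exact ad_smul_tmk (h.a_x _ p.1.2) (h.d_x _ p.1.2) (h.a_y _) (h'.a_x _ p.2.2)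
        (h'.d_x _ p.2.2) (h'.a_y _) (h'.weight_x _) (h'.weight_y _)
    simp only [had] at hz
    have hv : v = 0 := by
      ext n
      -- The sum of all coordinates at y_i ⊗ y'_j with i + j = n kills every ad(x_i ⊗ x'_j), whose
      -- two terms share an antidiagonal, and selects the n-th vector of the path.
      let ψ := ∑ q ∈ antidiagonal n.val,
        functional (cosyzCoord k r s q.1) (cosyzCoord k r' t q.2)
      have hψ : ∀ a b, a ≤ s → b ≤ t → ψ (tmk k (cosyzY k r s a) (cosyzY k r' t b)) =
          if a + b = n.val then 1 else 0 := fun a b ha hb => by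
        rw [← sum_antidiagonal_ite]
        simp only [ψ, LinearMap.sum_apply, functional_tmk]
        refine sum_congr rfl fun q _ => ?_
        rw [cosyzCoord_cosyzY _ _ ha, cosyzCoord_cosyzY _ _ hb]
        simp
      have := congrArg ψ hz
      simp only [map_add, map_sum, map_smul, map_sub, map_zero] at this
      rw [sum_eq_zero (s := (univ : Finset (Fin s × Fin t))) fun p _ => by
        rw [hψ _ _ (by omega) (by omega), hψ _ _ (by omega) (by omega), ← add_assoc,
          add_right_comm, sub_self, smul_zero, smul_zero], add_zero,
        sum_eq_single n (fun m _ hm => by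
          rw [hψ _ _ (by omega) (by omega), if_neg (fun h => hm (Fin.ext (by omega))), smul_zero])
          (by simp),
        hψ _ _ (by omega) (by omega), if_pos (by omega), smul_eq_mul, mul_one] at this
      exact this
    refine ⟨hv, ?_⟩
    simp only [hv, Pi.zero_apply, zero_smul, sum_const_zero, zero_add] at hz
    -- The vector y_i ⊗ y'_{j+1} occurs only in ad(x_i ⊗ x'_j) and ad(x_{i-1} ⊗ x'_{j+1}); the
    -- coefficient of the latter vanishes by induction on i.
    have key : ∀ m, ∀ p : Fin s × Fin t, p.1.val = m → z p = 0 := by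
      intro m
      induction m using Nat.strong_induction_on with
      | _ m ih =>
        rintro ⟨i, j⟩ rfl
        let ψ := functional (cosyzCoord k r s i) (cosyzCoord k r' t (j + 1))
        have hψ : ∀ a b, a ≤ s → b ≤ t → ψ (tmk k (cosyzY k r s a) (cosyzY k r' t b)) =
            if a = i.val ∧ b = j.val + 1 then 1 else 0 := fun a b ha hb => by
          simp only [ψ, functional_tmk]
          rw [cosyzCoord_cosyzY _ _ ha, cosyzCoord_cosyzY _ _ hb]
          split_ifs <;> simp_all
        have := congrArg ψ hz
        simp only [map_sum, map_smul, map_sub, map_zero] at this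
        rw [sum_eq_single (i, j) (fun p _ hp => by
            rw [hψ _ _ (by omega) (by omega), hψ _ _ (by omega) (by omega), if_neg (fun h =>
              hp (Prod.ext (Fin.ext h.1) (Fin.ext (by simpa using h.2))))]
            split_ifs with h
            · rw [ih p.1 (by simp; omega) p rfl, zero_smul]
            · rw [sub_self, smul_zero, smul_zero]) (by simp),
          hψ _ _ (by grind) (by grind), hψ _ _ (by grind) (by grind),
          if_pos ⟨rfl, rfl⟩, if_neg (by simp), sub_zero, smul_eq_mul, smul_eq_mul, mul_one] at this
        exact (mul_eq_zero.1 this).resolve_right fun h => by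
          simpa [h] using sign_mul_self (k := k) r'
    exact fun p => key _ p rfl
  · rw [finrank_diagTensor, finrank_KCarrier, finrank_KCarrier]
    simp
    ring

/-! ### The theorem -/

theorem nonempty_equiv_of_model (hk : (2 : k) ≠ 0) {M N L : FDMod k (D4 k)}
    {M' N' L' : Type u} [AddCommGroup M'] [Module k M'] [Module (D4 k) M']
    [IsScalarTower k (D4 k) M'] [AddCommGroup N'] [Module k N'] [Module (D4 k) N']
    [IsScalarTower k (D4 k) N'] [AddCommGroup L'] [Module (D4 k) L'] {s t : ℕ} {ρ : ZMod 2}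
    (hM : Nonempty (M ≃ₗ[D4 k] M')) (hN : Nonempty (N ≃ₗ[D4 k] N'))
    (hL : Nonempty (L ≃ₗ[D4 k] L'))
    (h : Nonempty (DiagTensor k (D4 k) M' N' ≃ₗ[D4 k] L' × (Fin s × Fin t → QCarrier k ρ))) :
    Nonempty (M.tensor N ≃ₗ[D4 k] L × (Fin (s * t) → P k ρ)) := by
  obtain ⟨eM⟩ := hM
  obtain ⟨eN⟩ := hN
  obtain ⟨eL⟩ := hL
  obtain ⟨e⟩ := h
  obtain ⟨eP⟩ := nonempty_P_equiv hk ρ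
  exact ⟨(tensorCongr eM eN).trans (e.trans (LinearEquiv.prodCongr eL.symm
    ((LinearEquiv.funCongrLeft (D4 k) (QCarrier k ρ) finProdFinEquiv.symm).trans
      (LinearEquiv.piCongrRight fun _ => eP.symm))))⟩

theorem nonempty_syzygy_tensor (hk : (2 : k) ≠ 0) (r r' : ZMod 2) {s t : ℕ} (hs : 1 ≤ s)
    (ht : 1 ≤ t) : Nonempty (((V k r).syzygy s).tensor ((V k r').syzygy t) ≃ₗ[D4 k]
      (V k (r + r')).syzygy (s + t) × (Fin (s * t) → P k (r + r' + (s + t : ℕ)))) := by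
  have h := nonempty_syz_tensor (k := k) (r + s) (r' + t) hs ht
  rw [add_add_add_comm, ← Nat.cast_add] at h
  exact nonempty_equiv_of_model hk (nonempty_syzygy_equiv hk r s) (nonempty_syzygy_equiv hk r' t)
    (nonempty_syzygy_equiv hk _ _) h

/-- The parameters r + s + 1 and r' + t + 1 add up to r + r' + s + t, since the two ones cancel in
ℤ/2. -/
theorem nonempty_cosyzygy_tensor (hk : (2 : k) ≠ 0) (r r' : ZMod 2) (s t : ℕ) :
    Nonempty (((V k r).cosyzygy s).tensor ((V k r').cosyzygy t) ≃ₗ[D4 k]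
      (V k (r + r')).cosyzygy (s + t) × (Fin (s * t) → P k (r + r' + (s + t : ℕ)))) := by
  have h := nonempty_cosyz_tensor (k := k) (r + s + 1) (r' + t + 1) s t
  rw [add_add_add_comm, add_add_add_comm r, ← Nat.cast_add, show (1 + 1 : ZMod 2) = 0 from rfl,
    add_zero] at h
  exact nonempty_equiv_of_model hk (nonempty_cosyzygy_equiv hk r s)
    (nonempty_cosyzygy_equiv hk r' t) (nonempty_cosyzygy_equiv hk _ _) h

end D4

end

/-- Decomposition of the tensor products of the syzygies, and of the cosyzygies, of the one
dimensional simple modules over `D₄`. -/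
theorem proposition2p14 (k : Type u) [Field k] [IsAlgClosed k] (hk : (2 : k) ≠ 0)
    (r r' : ZMod 2) (s t : ℕ) (hs : 1 ≤ s) (ht : 1 ≤ t) :
    (Even (s + t) →
      Nonempty (((D4.V k r).syzygy s).tensor ((D4.V k r').syzygy t) ≃ₗ[D4 k]
        (D4.V k (r + r')).syzygy (s + t) × (Fin (s * t) → D4.P k (r + r'))) ∧
      Nonempty (((D4.V k r).cosyzygy s).tensor ((D4.V k r').cosyzygy t) ≃ₗ[D4 k]
        (D4.V k (r + r')).cosyzygy (s + t) × (Fin (s * t) → D4.P k (r + r')))) ∧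
    (Odd (s + t) →
      Nonempty (((D4.V k r).syzygy s).tensor ((D4.V k r').syzygy t) ≃ₗ[D4 k]
        (D4.V k (r + r')).syzygy (s + t) × (Fin (s * t) → D4.P k (r + r' + 1))) ∧
      Nonempty (((D4.V k r).cosyzygy s).tensor ((D4.V k r').cosyzygy t) ≃ₗ[D4 k]
        (D4.V k (r + r')).cosyzygy (s + t) × (Fin (s * t) → D4.P k (r + r' + 1)))) := by
  have h1 := D4.nonempty_syzygy_tensor hk r r' hs ht
  have h2 := D4.nonempty_cosyzygy_tensor hk r r' s t
  refine ⟨fun h => ?_, fun h => ?_⟩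
  · rw [(ZMod.natCast_eq_zero_iff_even (n := s + t)).2 h, add_zero] at h1 h2
    exact ⟨h1, h2⟩
  · rw [(ZMod.natCast_eq_one_iff_odd (n := s + t)).2 h] at h1 h2
    exact ⟨h1, h2⟩
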